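/- Let $A,B>0$ and $\alpha,\beta\ge 0$. For $k\ge 1$, call a sequence $(p_n)_{n\ge1}$, with $p_n$ a probability vector on $\{1,\dots,n\}$, \emph{admissible from time $k$} if $$\frac{A(\log n)^{-\alpha}}{n}\;\le\; p_n(j)\;\le\;\frac{B(\log n)^{\beta}}{n}\qquad\text{for all } n\ge \max\{k,2\}\text{ and all } 1\le j\le n .$$ (i) If $\alpha+\beta/2\le 1$, then for all $d\geq 0$ and $k\ge1$, all $(p_n)$ admissible from time $k$ and every initialization $a_1,\dots,a_k\in\mathbb{R}^d$, the sequence defined by $a_{n+1}=\sum_{j=1}^n p_n(j)\,a_j$ for all $n\ge k$ converges in $\mathbb{R}^d$. (ii) If $\alpha,\beta>0$ and $\alpha+\beta/2>1$, then for every $d\ge1$ there exist $k\ge1$, a sequence $(p_n)$ admissible from time $k$ and an initialization $a_1,\dots,a_k\in\mathbb{R}^d$ such that the sequence defined by $a_{n+1}=\sum_{j=1}^n p_n(j)\,a_j$ for all $n\ge k$ does not converge. -/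

import Mathlib

/-- The real weights `w 1, …, w n` form a probability vector on `{1, …, n}`. Values of `w` at other
indices play no role. -/
def IsProbabilityVector (n : ℕ) (w : ℕ → ℝ) : Prop :=
  (∀ j ∈ Finset.Icc 1 n, 0 ≤ w j) ∧ ∑ j ∈ Finset.Icc 1 n, w j = 1

/-- `p n` is a probability vector on `{1, …, n}` for every `n ≥ 1`, and from time `k` on its entries
lie between the floor `A (log n)^(-α) / n` and the ceiling `B (log n)^β / n`. The envelope is not
imposed at `n = 1`, where `log n = 0`. -/
structure IsAdmissible (A B α β : ℝ) (k : ℕ) (p : ℕ → ℕ → ℝ) : Prop where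
  prob : ∀ n : ℕ, 1 ≤ n → IsProbabilityVector n (p n)
  floor : ∀ n : ℕ, k ≤ n → 2 ≤ n → ∀ j ∈ Finset.Icc 1 n,
    A * Real.log (n : ℝ) ^ (-α) / (n : ℝ) ≤ p n j
  ceiling : ∀ n : ℕ, k ≤ n → 2 ≤ n → ∀ j ∈ Finset.Icc 1 n,
    p n j ≤ B * Real.log (n : ℝ) ^ β / (n : ℝ)

/-- `a 1, …, a k` is an arbitrary initialization, and every later term is the weighted average
`a (n + 1) = ∑_{j = 1}^n p n j • a j`. The value `a 0` plays no role. -/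
def IsAveragingSequence {d : ℕ} (k : ℕ) (p : ℕ → ℕ → ℝ)
    (a : ℕ → EuclideanSpace ℝ (Fin d)) : Prop :=
  ∀ n : ℕ, k ≤ n → a (n + 1) = ∑ j ∈ Finset.Icc 1 n, p n j • a j

/-- The sequence has a limit. -/
def SequenceConverges {d : ℕ} (a : ℕ → EuclideanSpace ℝ (Fin d)) : Prop :=
  ∃ L : EuclideanSpace ℝ (Fin d), Filter.Tendsto a Filter.atTop (nhds L)

/-! Part (i). It suffices to treat each coordinate. If a bounded scalar sequence is not Cauchy,
every tail has oscillation at least some `D > 0`. Write `T = log N`, and let `x` be the distance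
from the top of the tail, scaled by the width of its bounding interval; on the window from `N` to `N
* q ^ 3`, with `q` about a power of `T`, the weights lie between `c / n` and `Λ / n`. With `δ = 1 /
(10 √Λ)` the key claim (`exists_gap`) is that on a stretch of ratio at least `q` the values stay at
distance of order `c δ` from the top or from the bottom. If the mean of `x` stays above `δ`, the
floor alone gives this. Otherwise both extremes are nearly reached in mean, say bottom at time `s`
and then top at time `t`. The flip forces `s` to be of order at most `δ t`, and only about a
fraction `δ` of the indices up to `s` can be near the top. These few indices, of order `δ² t`, carry
weight at most about `Λ δ²`, too little to pull new values back to the top. This is why `√Λ`, and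
hence `β / 2`, appears.

Such a gap persists forever up to half its size (`le_of_nonpos_stretch`), since the values before
the stretch carry little weight. So a window lowers the oscillation by order `c δ`, which is at
least of order `1 / T` when `α + β / 2 ≤ 1`. Meanwhile `log N` grows by `O(log T)`, so the triple
logarithm of `N` grows by `O(1 / T)`. The oscillation bound plus a small multiple of the triple
logarithm therefore never increases along successive windows (`exists_oscillation_drop`), which is
absurd because the triple logarithm diverges.

Part (ii). Blocks `(K w, 2 K w]` grow by ratios `Q w` of order `w ^ (β / 2)`. Apart from the
compulsory uniform part `c / n`, the weights of each cycle sit on the block before the last one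
completed, so block `w + 2` copies block `w` and the values alternate between near `1` and near `0`.
The ceiling permits this because two growth ratios cost a factor `Q²`. The uniform part spoils a
copy by at most `4 c / Q`, of order `w ^ (-(α + β / 2))`, which is summable
(`CycleData.abs_values_sub_le`). -/

/-! ### Gaps inside one averaging window -/

/-- On the time window `[N, L]` the weights lie between `c / n` and `Λ / n`, the sequence `x` is
averaged by them, it lies in `[0, 1]` from time `N` on, and in `[-R, 1 + R]` before. -/
structure AveragingWindow (p : ℕ → ℕ → ℝ) (x : ℕ → ℝ) (N L : ℕ) (c Λ R : ℝ) : Prop where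
  sum_eq_one : ∀ n, N ≤ n → n ≤ L → ∑ j ∈ Finset.Icc 1 n, p n j = 1
  floor : ∀ n, N ≤ n → n ≤ L → ∀ j ∈ Finset.Icc 1 n, c / n ≤ p n j
  ceiling : ∀ n, N ≤ n → n ≤ L → ∀ j ∈ Finset.Icc 1 n, p n j ≤ Λ / n
  average : ∀ n, N ≤ n → n ≤ L → x (n + 1) = ∑ j ∈ Finset.Icc 1 n, p n j * x j
  nonneg : ∀ j, N ≤ j → 0 ≤ x j
  le_one : ∀ j, N ≤ j → x j ≤ 1
  lower : ∀ j, 1 ≤ j → -R ≤ x j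
  upper : ∀ j, 1 ≤ j → x j ≤ 1 + R

theorem sum_Icc_indicator_lt_le (N n : ℕ) {w : ℝ} (hw : 0 ≤ w) :
    ∑ j ∈ Finset.Icc 1 n, (if j < N then w else 0) ≤ N * w := by
  rw [← Finset.sum_filter, Finset.sum_const, nsmul_eq_mul]
  refine mul_le_mul_of_nonneg_right ?_ hw
  have h : (Finset.Icc 1 n).filter (fun j => j < N) ⊆ Finset.range N := by
    intro j hj
    simp at hj ⊢
    exact hj.2
  have := Finset.card_le_card h
  rw [Finset.card_range] at this
  exact_mod_cast this

theorem sum_Icc_indicator_le {t n : ℕ} (h : t ≤ n) (f : ℕ → ℝ) :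
    ∑ j ∈ Finset.Icc 1 n, (if j ≤ t then f j else 0) = ∑ j ∈ Finset.Icc 1 t, f j := by
  rw [← Finset.sum_filter]
  congr 1
  ext j
  simp only [Finset.mem_filter, Finset.mem_Icc]
  omega

namespace AveragingWindow

variable {p : ℕ → ℕ → ℝ} {x : ℕ → ℝ} {N L : ℕ} {c Λ R : ℝ}

/-- Exchanges top and bottom, so that one-sided estimates serve for both. -/
theorem reflect (W : AveragingWindow p x N L c Λ R) :
    AveragingWindow p (fun j => 1 - x j) N L c Λ R where
  sum_eq_one := W.sum_eq_one
  floor := W.floor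
  ceiling := W.ceiling
  average n h1 h2 := by
    simp only [mul_sub, mul_one, Finset.sum_sub_distrib]
    rw [W.sum_eq_one n h1 h2, W.average n h1 h2]
  nonneg j hj := by linarith [W.le_one j hj]
  le_one j hj := by linarith [W.nonneg j hj]
  lower j hj := by linarith [W.upper j hj]
  upper j hj := by linarith [W.lower j hj]

/-- The floor turns a mean of at least `δ` into a value of at least `c * δ`; each of the fewer than
`N` early terms, possibly negative, costs at most `R * Λ / n`. -/
theorem le_succ_of_le_sum (W : AveragingWindow p x N L c Λ R) (hN : 1 ≤ N) (hc : 0 ≤ c)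
    (hΛ : 0 ≤ Λ) (hR : 0 ≤ R) {δ : ℝ} {n : ℕ} (h1 : N ≤ n) (h2 : n ≤ L)
    (h : δ * n ≤ ∑ j ∈ Finset.Icc 1 n, x j) :
    c * δ - R * N * Λ / n ≤ x (n + 1) := by
  have hn : (0 : ℝ) < n := by exact_mod_cast (by omega : 0 < n)
  have key : ∀ j ∈ Finset.Icc 1 n,
      c / n * x j - (if j < N then R * Λ / n else 0) ≤ p n j * x j := by
    intro j hj
    have hf := W.floor n h1 h2 j hj
    have hce := W.ceiling n h1 h2 j hj
    split_ifs with hjN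
    · have hl := W.lower j (Finset.mem_Icc.1 hj).1
      have hcn : 0 ≤ c / n := by positivity
      have e1 : (p n j - c / n) * (-R) ≤ (p n j - c / n) * x j :=
        mul_le_mul_of_nonneg_left hl (by linarith)
      have e2 : (p n j - c / n) * R ≤ Λ / n * R := mul_le_mul_of_nonneg_right (by linarith) hR
      have e3 : R * Λ / n = Λ / n * R := by ring
      rw [e3]
      linarith
    · have := mul_le_mul_of_nonneg_right hf (W.nonneg j (by omega))
      linarith
  have hs := Finset.sum_le_sum key
  rw [Finset.sum_sub_distrib, ← Finset.mul_sum, ← W.average n h1 h2] at hs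
  have h3 := sum_Icc_indicator_lt_le N n (w := R * Λ / n) (by positivity)
  have h4 : c / n * (δ * n) ≤ c / n * ∑ j ∈ Finset.Icc 1 n, x j :=
    mul_le_mul_of_nonneg_left h (by positivity)
  have h5 : c / n * (δ * n) = c * δ := by field_simp
  have h6 : N * (R * Λ / n) = R * N * Λ / n := by ring
  linarith

set_option maxHeartbeats 1000000 in
/-- After a time `s` at which most of the mass is near the bottom, followed by a first time `t` at
which most of the mass is near the top, every new value keeps a definite distance from the top. -/
theorem le_of_bottom_then_top (W : AveragingWindow p x N L c Λ R) (hN : 1 ≤ N) (hc : 0 < c)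
    (hc1 : c ≤ 1) (hΛ : 1 ≤ Λ) (hR : 0 ≤ R) {δ : ℝ} (hδ : 0 < δ) (hδΛ : 100 * δ ^ 2 * Λ ≤ 1)
    {s t : ℕ} (hs : 1000 * (R * N * Λ) ≤ c * δ * s) (hs2 : 1000 ≤ s) (hNs : N ≤ s) (hst : s < t)
    (htL : t ≤ L)
    (hbot : ∑ j ∈ Finset.Icc 1 s, (1 - x j) ≤ δ * s)
    (htop : ∑ j ∈ Finset.Icc 1 t, x j ≤ δ * t)
    (hmid : ∀ n, s ≤ n → n < t → δ * n < ∑ j ∈ Finset.Icc 1 n, x j) :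
    ∀ n, s < n → n ≤ L → c * δ / 8 ≤ x n := by
  have hδ1 : δ ≤ 1 / 10 := by nlinarith
  have hsR : (1000 : ℝ) ≤ s := by exact_mod_cast hs2
  have hstR : (s : ℝ) + 1 ≤ t := by exact_mod_cast hst
  have hcδ : 0 < c * δ := by positivity
  -- The exceptional indices: those up to `s` already in the upper half, where `x` measures distance
  -- from the top. Their number `u` does not change after `s`.
  set o : ℕ → ℝ := fun j => if j ≤ s ∧ x j < 1 / 2 then 1 else 0 with ho
  have ho0 : ∀ j, 0 ≤ o j := by intro j; simp only [ho]; split_ifs <;> norm_num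
  set u : ℝ := ∑ j ∈ Finset.Icc 1 s, o j with hu
  have hu0 : 0 ≤ u := Finset.sum_nonneg fun j _ => ho0 j
  have hou : ∀ n, s ≤ n → ∑ j ∈ Finset.Icc 1 n, o j = u := by
    intro n hn
    rw [hu, ← sum_Icc_indicator_le hn]
    refine Finset.sum_congr rfl fun j _ => ?_
    simp only [ho]
    split_ifs <;> first | rfl | (exfalso; tauto)
  have hRN := sum_Icc_indicator_lt_le N s hR
  have hRNt := sum_Icc_indicator_lt_le N t hR
  have ha : u / 2 - R * N ≤ δ * s := by
    have key : ∀ j ∈ Finset.Icc 1 s, o j / 2 - (if j < N then R else 0) ≤ 1 - x j := by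
      intro j hj
      have hu1 := W.upper j (Finset.mem_Icc.1 hj).1
      simp only [ho]
      by_cases hjN : j < N
      · rw [if_pos hjN]
        split_ifs with h
        · linarith [h.2]
        · linarith
      · rw [if_neg hjN]
        have := W.le_one j (by omega)
        split_ifs with h
        · linarith [h.2]
        · linarith
    have := Finset.sum_le_sum key
    rw [Finset.sum_sub_distrib, ← Finset.sum_div] at this
    linarith
  have hb : (s - u) / 2 - R * N ≤ δ * t := by
    have key : ∀ j ∈ Finset.Icc 1 t,
        (if j ≤ s then (1 - o j) / 2 else 0) - (if j < N then R else 0) ≤ x j := by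
      intro j hj
      have hu1 := W.lower j (Finset.mem_Icc.1 hj).1
      by_cases hjs : j ≤ s
      · rw [if_pos hjs]
        simp only [ho]
        by_cases hjN : j < N
        · rw [if_pos hjN]
          split_ifs with h
          · linarith
          · have : 1 / 2 ≤ x j := by by_contra h'; exact h ⟨hjs, not_le.1 h'⟩
            linarith
        · rw [if_neg hjN]
          have := W.nonneg j (by omega)
          split_ifs with h
          · linarith
          · have : 1 / 2 ≤ x j := by by_contra h'; exact h ⟨hjs, not_le.1 h'⟩
            linarith
      · rw [if_neg hjs, if_neg (by omega)]
        linarith [W.nonneg j (by omega)]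
    have := Finset.sum_le_sum key
    rw [Finset.sum_sub_distrib, sum_Icc_indicator_le hst.le, ← Finset.sum_div,
      Finset.sum_sub_distrib, Finset.sum_const, Nat.card_Icc, nsmul_eq_mul] at this
    simp only [Nat.add_sub_cancel, mul_one] at this
    linarith
  have hρ0 : 0 ≤ R * N := by positivity
  have hst' : c * δ * s ≤ c * δ * t := mul_le_mul_of_nonneg_left (by linarith) hcδ.le
  have hρΛ : R * N ≤ R * N * Λ := le_mul_of_one_le_right hρ0 hΛ
  have hcδt : c * δ * t ≤ δ * t := by
    have : 0 ≤ δ * t := by positivity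
    nlinarith
  -- Up to `s` almost all indices have `x ≥ 1 / 2`, yet the sum of `x` up to `t` is at most `δ * t`:
  -- so `s` is a small part of `t`.
  have hs_le : (s : ℝ) ≤ 5 / 2 * δ * t + 5 * (R * N) := by
    have : δ * s ≤ 1 / 10 * s := by gcongr
    linarith
  have hu_le : u ≤ 5 * δ ^ 2 * t + 3 * (R * N) := by
    have h1 : δ * s ≤ δ * (5 / 2 * δ * t + 5 * (R * N)) := by gcongr
    have h2 : δ * (R * N) ≤ 1 / 10 * (R * N) := by gcongr
    nlinarith
  have huΛ : u * Λ ≤ t / 10 := by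
    have h1 : u * Λ ≤ (5 * δ ^ 2 * t + 3 * (R * N)) * Λ := by gcongr
    have h2 : (100 * δ ^ 2 * Λ) * t ≤ 1 * t := by gcongr
    have h3 : δ * t ≤ 1 / 10 * t := by gcongr
    nlinarith
  have hu_le' : u ≤ 51 / 100 * (δ * t) := by
    have h1 : δ * (δ * t) ≤ 1 / 10 * (δ * t) := by gcongr
    nlinarith
  -- As `t` is the first time the sum falls to `δ * t`, it was larger at `t - 1`, and one step of a
  -- nonnegative sequence loses little.
  have hsumt : 99 / 100 * (δ * t) ≤ ∑ j ∈ Finset.Icc 1 t, x j := by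
    obtain ⟨r, rfl⟩ : ∃ r, t = r + 1 := ⟨t - 1, by omega⟩
    have h1 := hmid r (by omega) (by omega)
    rw [Finset.sum_Icc_succ_top (by omega)]
    have h2 := W.nonneg (r + 1) (by omega)
    have h3 : (100 : ℝ) ≤ (r + 1 : ℕ) := by linarith
    have h4 : δ * 100 ≤ δ * ((r + 1 : ℕ) : ℝ) := by gcongr
    push_cast at *
    linarith
  have hbefore : ∀ j, s < j → j ≤ t → c * δ / 8 ≤ x j := by
    intro j h1 h2
    obtain ⟨r, rfl⟩ : ∃ r, j = r + 1 := ⟨j - 1, by omega⟩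
    have h3 := W.le_succ_of_le_sum hN hc.le (by linarith) hR (n := r) (by omega) (by omega)
      (hmid r (by omega) (by omega)).le
    have hr : (s : ℝ) ≤ r := by exact_mod_cast (by omega : s ≤ r)
    have h4 : R * N * Λ / r ≤ c * δ / 1000 := by
      rw [div_le_iff₀ (by linarith)]
      have : c * δ * s ≤ c * δ * r := by gcongr
      linarith
    linarith
  -- Bootstrap over all non-exceptional indices. The exceptional ones cost at most `c * δ / 8 * (Λ *
  -- u / n)`, while the floor collects a surplus of `c * δ * t / (2 * n)` from the indices up to
  -- `t`. Both scale as `t / n`, and `Λ * u ≤ t / 10` makes the surplus win at every later time.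
  have hinv : ∀ n, t ≤ n → n ≤ L → ∀ j ∈ Finset.Icc 1 n, o j = 0 → c * δ / 8 ≤ x j := by
    intro n hn
    induction n, hn using Nat.le_induction with
    | base =>
      intro _ j hj h0
      rw [Finset.mem_Icc] at hj
      by_cases hjs : j ≤ s
      · have : ¬ x j < 1 / 2 := by
          intro h
          simp only [ho, if_pos (And.intro hjs h)] at h0
          exact one_ne_zero h0
        nlinarith
      · exact hbefore j (by omega) hj.2
    | succ n hn ih =>
      intro hL j hj h0
      have ih' := ih (by omega)
      rcases Nat.lt_or_ge j (n + 1) with hlt | hge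
      · exact ih' j (by rw [Finset.mem_Icc] at hj ⊢; omega) h0
      obtain rfl : j = n + 1 := by rw [Finset.mem_Icc] at hj; omega
      have hNn : N ≤ n := by omega
      have hnL : n ≤ L := by omega
      have hnt : (t : ℝ) ≤ n := by exact_mod_cast hn
      have hn0 : (0 : ℝ) < n := by linarith
      have key : ∀ i ∈ Finset.Icc 1 n,
          c * δ / 8 * (p n i - Λ / n * o i) +
            (if i ≤ t then c / n * (x i - c * δ / 8 - o i / 2) else 0)
            - (if i < N then R * Λ / n else 0) ≤ p n i * x i := by
        intro i hi
        have hf := W.floor n hNn hnL i hi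
        have hce := W.ceiling n hNn hnL i hi
        have hl := W.lower i (Finset.mem_Icc.1 hi).1
        have hcn : 0 ≤ c / n := by positivity
        have hRΛ : 0 ≤ R * Λ / n := by positivity
        by_cases hoi : o i = 0
        · have hxi := ih' i hi hoi
          rw [hoi]
          have e1 : (if i ≤ t then c / n * (x i - c * δ / 8 - 0 / 2) else 0)
              ≤ p n i * (x i - c * δ / 8) := by
            split_ifs
            · rw [zero_div, sub_zero]
              exact mul_le_mul_of_nonneg_right hf (by linarith)
            · exact mul_nonneg (by linarith) (by linarith)
          have e2 : 0 ≤ (if i < N then R * Λ / n else 0) := by split_ifs <;> simp [hRΛ]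
          linarith
        · have hi' : i ≤ s ∧ x i < 1 / 2 := by
            by_contra h
            exact hoi (by simp only [ho]; rw [if_neg h])
          have ho1 : o i = 1 := by simp only [ho]; rw [if_pos hi']
          rw [ho1, if_pos (by omega)]
          have e1 : c * δ / 8 * (p n i - Λ / n * 1) ≤ 0 :=
            mul_nonpos_of_nonneg_of_nonpos (by positivity) (by linarith)
          have e2 : c / n * (x i - c * δ / 8 - 1 / 2) ≤ 0 :=
            mul_nonpos_of_nonneg_of_nonpos hcn (by linarith [hi'.2])
          split_ifs with hiN
          · have e3 : p n i * (-R) ≤ p n i * x i :=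
              mul_le_mul_of_nonneg_left hl (by linarith)
            have e4 : p n i * R ≤ Λ / n * R := mul_le_mul_of_nonneg_right hce hR
            have e5 : R * Λ / n = Λ / n * R := by ring
            linarith
          · have := mul_nonneg (hcn.trans hf) (W.nonneg i (by omega))
            linarith
      have hsum := Finset.sum_le_sum key
      rw [← W.average n hNn hnL, Finset.sum_sub_distrib, Finset.sum_add_distrib,
        sum_Icc_indicator_le hn, ← Finset.mul_sum, ← Finset.mul_sum, Finset.sum_sub_distrib,
        Finset.sum_sub_distrib, Finset.sum_sub_distrib, ← Finset.mul_sum, ← Finset.sum_div,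
        ← Finset.sum_div,
        W.sum_eq_one n hNn hnL, hou n (by omega), hou t hst.le, Finset.sum_const, Nat.card_Icc,
        nsmul_eq_mul, Nat.add_sub_cancel] at hsum
      have hI := sum_Icc_indicator_lt_le N n (w := R * Λ / n) (by positivity)
      have hcδ8 : c * δ / 8 ≤ δ / 8 := by nlinarith
      have hc8t : (t : ℝ) * (c * δ / 8) ≤ t * (δ / 8) := by gcongr
      have m1 : c / n * (1 / 2 * (δ * t)) ≤
          c / n * (∑ j ∈ Finset.Icc 1 t, x j - t * (c * δ / 8) - u / 2) := by
        apply mul_le_mul_of_nonneg_left _ (by positivity)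
        have : 0 ≤ δ * t := by positivity
        linarith
      have m2 : c * δ / 8 * (Λ / n * u) ≤ c * δ / 8 * (t / 10 / n) := by
        apply mul_le_mul_of_nonneg_left _ (by positivity)
        rw [div_mul_eq_mul_div]
        gcongr
        linarith
      have m3 : N * (R * Λ / n) ≤ c * δ * t / 1000 / n := by
        rw [← mul_div_assoc]
        gcongr
        linarith
      have m4 : c * δ / 8 * (t / 10 / n) + c * δ * t / 1000 / n ≤ c / n * (1 / 2 * (δ * t)) := by
        have : 0 ≤ c * δ * t / n := by positivity
        have e1 : c * δ / 8 * (t / 10 / n) = 1 / 80 * (c * δ * t / n) := by ring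
        have e2 : c * δ * t / 1000 / n = 1 / 1000 * (c * δ * t / n) := by ring
        have e3 : c / n * (1 / 2 * (δ * t)) = 1 / 2 * (c * δ * t / n) := by ring
        rw [e1, e2, e3]
        linarith
      linarith
  intro n h1 h2
  by_cases hnt : n ≤ t
  · exact hbefore n h1 hnt
  · refine hinv n (by omega) h2 n (by rw [Finset.mem_Icc]; omega) ?_
    simp only [ho]
    rw [if_neg (by omega)]

/-- On a stretch that is long in ratio, the sequence keeps a definite distance from the top or from
the bottom. -/
theorem exists_gap (W : AveragingWindow p x N L c Λ R) (hN : 1 ≤ N) (hc : 0 < c)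
    (hc1 : c ≤ 1) (hΛ : 1 ≤ Λ) (hR : 0 ≤ R) {δ : ℝ} (hδ : 0 < δ) (hδΛ : 100 * δ ^ 2 * Λ ≤ 1)
    {q : ℕ} (hq1 : 1000 ≤ q) (hq : 1000 * (R * Λ) ≤ c * δ * q) (hL : L = N * q ^ 3) :
    ∃ v u : ℕ, N ≤ v ∧ v * q ≤ u ∧ u ≤ L ∧
      ((∀ n, v < n → n ≤ u → c * δ / 8 ≤ x n) ∨ (∀ n, v < n → n ≤ u → c * δ / 8 ≤ 1 - x n)) := by
  have hδ1 : δ ≤ 1 / 10 := by nlinarith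
  have hcδ : 0 < c * δ := by positivity
  have hNR : (0 : ℝ) < N := by exact_mod_cast hN
  -- The three factors of `q` have separate roles: the first makes the terms before `N` negligible,
  -- the second is the range searched for extreme means, the third leaves a stretch of ratio `q`
  -- after any time found there.
  have hlarge : ∀ n : ℕ, N * q ≤ n → 1000 * (R * N * Λ) ≤ c * δ * n := by
    intro n hn
    have h1 : (N : ℝ) * q ≤ n := by exact_mod_cast hn
    have h2 : c * δ * (N * q) ≤ c * δ * n := by gcongr
    have h3 : N * (1000 * (R * Λ)) ≤ N * (c * δ * q) := by gcongr
    linarith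
  have hNq : N ≤ N * q := Nat.le_mul_of_pos_right _ (by omega)
  have hNqq : N * q ≤ N * q * q := Nat.le_mul_of_pos_right _ (by omega)
  have hNqqq : N * q * q ≤ N * q * q * q := Nat.le_mul_of_pos_right _ (by omega)
  have hLe : L = N * q * q * q := by rw [hL]; ring
  have hq0 : 1000 ≤ N * q := hq1.trans (Nat.le_mul_of_pos_left _ hN)
  have nocheap : ∀ {y : ℕ → ℝ}, AveragingWindow p y N L c Λ R →
      (∀ n, N * q ≤ n → n ≤ N * q * q → δ * n ≤ ∑ j ∈ Finset.Icc 1 n, y j) →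
      ∀ n, N * q < n → n ≤ N * q * q → c * δ / 8 ≤ y n := by
    intro y Wy h n h1 h2
    obtain ⟨r, rfl⟩ : ∃ r, n = r + 1 := ⟨n - 1, by omega⟩
    have h3 := Wy.le_succ_of_le_sum hN hc.le (by linarith) hR (n := r) (by omega) (by omega)
      (h r (by omega) (by omega))
    have hr : (0 : ℝ) < r := by exact_mod_cast (by omega : 0 < r)
    have h4 : R * N * Λ / r ≤ c * δ / 1000 := by
      rw [div_le_iff₀ hr]
      linarith [hlarge r (by omega)]
    linarith
  have order : ∀ {y : ℕ → ℝ}, AveragingWindow p y N L c Λ R → ∀ {s t : ℕ}, N * q ≤ s → s < t →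
      t ≤ N * q * q → ∑ j ∈ Finset.Icc 1 s, (1 - y j) ≤ δ * s →
      ∑ j ∈ Finset.Icc 1 t, y j ≤ δ * t → ∀ n, s < n → n ≤ L → c * δ / 8 ≤ y n := by
    intro y Wy s t hs hst ht hbot htop
    classical
    -- Passing to the first top time after `s` supplies the lower bound on the sums in between.
    have hex : ∃ t, s < t ∧ ∑ j ∈ Finset.Icc 1 t, y j ≤ δ * t := ⟨t, hst, htop⟩
    have hle : Nat.find hex ≤ t := Nat.find_min' hex ⟨hst, htop⟩
    refine Wy.le_of_bottom_then_top hN hc hc1 hΛ hR hδ hδΛ (hlarge s hs) (by omega) (by omega)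
      (Nat.find_spec hex).1 (by omega) hbot (Nat.find_spec hex).2 ?_
    intro n h1 h2
    rcases h1.eq_or_lt with rfl | h1
    · rw [Finset.sum_sub_distrib, Finset.sum_const, Nat.card_Icc, nsmul_eq_mul,
        Nat.add_sub_cancel] at hbot
      have : (0 : ℝ) < s := by exact_mod_cast (by omega : 0 < s)
      nlinarith
    · have := Nat.find_min hex h2
      by_contra h
      exact this ⟨h1, not_lt.1 h⟩
  by_cases hT : ∃ t, N * q ≤ t ∧ t ≤ N * q * q ∧ ∑ j ∈ Finset.Icc 1 t, x j ≤ δ * t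
  swap
  · refine ⟨N * q, N * q * q, hNq, le_rfl, by omega, Or.inl (nocheap W ?_)⟩
    intro n h1 h2
    by_contra h
    exact hT ⟨n, h1, h2, (not_le.1 h).le⟩
  by_cases hB : ∃ s, N * q ≤ s ∧ s ≤ N * q * q ∧ ∑ j ∈ Finset.Icc 1 s, (1 - x j) ≤ δ * s
  swap
  · refine ⟨N * q, N * q * q, hNq, le_rfl, by omega, Or.inr (nocheap W.reflect ?_)⟩
    intro n h1 h2
    by_contra h
    exact hB ⟨n, h1, h2, (not_le.1 h).le⟩
  obtain ⟨t, ht1, ht2, ht⟩ := hT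
  obtain ⟨s, hs1, hs2, hs⟩ := hB
  have hmul : ∀ {n : ℕ}, n ≤ N * q * q → n * q ≤ L := fun {n} h => by
    rw [hLe]; exact Nat.mul_le_mul_right _ h
  rcases lt_trichotomy s t with h | h | h
  · exact ⟨s, L, by omega, hmul hs2, le_rfl, Or.inl (order W hs1 h ht2 hs ht)⟩
  · subst h
    rw [Finset.sum_sub_distrib, Finset.sum_const, Nat.card_Icc, nsmul_eq_mul,
        Nat.add_sub_cancel] at hs
    have : (0 : ℝ) < s := by exact_mod_cast (by omega : 0 < s)
    nlinarith
  · exact ⟨t, L, by omega, hmul ht2, le_rfl,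
      Or.inr (order W.reflect ht1 h hs2 (by simpa using ht) hs)⟩

end AveragingWindow

/-! ### Persistence of a gap after a long stretch -/

theorem sum_Icc_indicator_gt_le (n : ℕ) {z w : ℝ} (hz : 0 ≤ z) (hw : 0 ≤ w) :
    ∑ j ∈ Finset.Icc 1 n, (if (j : ℝ) ≤ n - z then 0 else w) ≤ (z + 1) * w := by
  have h : ∑ j ∈ Finset.Icc 1 n, (if (j : ℝ) ≤ n - z then 0 else w) ≤
      ∑ j ∈ Finset.Ico (n - ⌊z⌋₊) (n + 1), w := by
    have e : ∀ j ∈ Finset.Icc 1 n, (if (j : ℝ) ≤ n - z then 0 else w) =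
        if ¬ (j : ℝ) ≤ n - z then w else 0 := by
      intro j _; split_ifs <;> rfl
    rw [Finset.sum_congr rfl e, ← Finset.sum_filter]
    refine Finset.sum_le_sum_of_subset_of_nonneg ?_ fun _ _ _ => hw
    intro j hj
    simp only [Finset.mem_filter, Finset.mem_Icc, not_le] at hj
    rw [Finset.mem_Ico]
    refine ⟨?_, by omega⟩
    have h1 : ((n - j : ℕ) : ℝ) ≤ z := by
      rw [Nat.cast_sub hj.1.2]; linarith [hj.2]
    have := Nat.le_floor h1
    omega
  refine h.trans ?_
  rw [Finset.sum_const, Nat.card_Ico, nsmul_eq_mul]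
  refine mul_le_mul_of_nonneg_right ?_ hw
  have h1 : ((n + 1 - (n - ⌊z⌋₊) : ℕ) : ℝ) ≤ ((⌊z⌋₊ + 1 : ℕ) : ℝ) := by
    exact_mod_cast (by omega : n + 1 - (n - ⌊z⌋₊) ≤ ⌊z⌋₊ + 1)
  have h2 := Nat.floor_le hz
  push_cast at h1
  linarith

/-- Amounts to `(1 + τ / 2) ^ 2 * (1 - τ) ≤ 1`. -/
theorem one_add_half_div_sqrt_le {x y τ : ℝ} (hx : 0 < x) (hy : 0 < y) (hτ : 0 ≤ τ)
    (h : x ≤ y - τ * y) : (1 + τ / 2) / √y ≤ 1 / √x := by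
  have hsx := Real.sqrt_pos.2 hx
  have hsy := Real.sqrt_pos.2 hy
  rw [div_le_div_iff₀ hsy hsx, one_mul]
  refine Real.le_sqrt_of_sq_le ?_
  rw [mul_pow, Real.sq_sqrt hx.le]
  have h1 : (1 + τ / 2) ^ 2 * x ≤ (1 + τ / 2) ^ 2 * (y - τ * y) := by gcongr
  have h2 : 0 ≤ τ ^ 2 * y * (3 + τ) := by positivity
  nlinarith

/-- If the values on `(v, u]` are nonpositive and the weights are at most `Λ n / n`, the values
before `v` can only lift the later ones by a small amount. -/
theorem le_of_nonpos_stretch {p : ℕ → ℕ → ℝ} {y : ℕ → ℝ} {Λ : ℕ → ℝ} {v u : ℕ} {R l : ℝ}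
    (hu : 1 ≤ u) (hR : 0 ≤ R) (hl : 0 ≤ l)
    (hsum : ∀ n, u ≤ n → ∑ j ∈ Finset.Icc 1 n, p n j = 1)
    (hp0 : ∀ n, u ≤ n → ∀ j ∈ Finset.Icc 1 n, 0 ≤ p n j)
    (hpΛ : ∀ n, u ≤ n → ∀ j ∈ Finset.Icc 1 n, p n j ≤ Λ n / n)
    (havg : ∀ n, u ≤ n → y (n + 1) = ∑ j ∈ Finset.Icc 1 n, p n j * y j)
    (hΛ1 : ∀ n, u ≤ n → 1 ≤ Λ n) (hΛ4 : ∀ n, u ≤ n → 4 * Λ n ≤ n)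
    (hy0 : ∀ j, v < j → j ≤ u → y j ≤ 0) (hyR : ∀ j, 1 ≤ j → j ≤ v → y j ≤ R)
    (hbar : ∀ n : ℕ, u ≤ n → 16 * (R * v * Λ n ^ 2) ≤ l * √n) (hvu : v < u) :
    ∀ n, u ≤ n → y n ≤ 2 * l / √u := by
  have huR : (0 : ℝ) < u := by exact_mod_cast hu
  have hsqrt : ∀ n : ℕ, u ≤ n → l / √n ≤ l / √u := by
    intro n hn
    have : (u : ℝ) ≤ n := by exact_mod_cast hn
    have h1 := Real.sqrt_le_sqrt this
    have h2 := Real.sqrt_pos.2 huR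
    gcongr
  -- An increasing barrier. Indices below `(1 - τ) * n` see a barrier lower by at least `l / √n * (τ
  -- / 2)`, and with `τ = 1 / (4 * Λ n)` the remaining recent indices carry weight at most `1 / 2`.
  -- Half of that drop is thus gained on average, and `hbar` says exactly that it pays for the
  -- values up to `v`.
  have main : ∀ n, u ≤ n → y n ≤ 2 * (l / √u) - l / √n := by
    intro n
    induction n using Nat.strong_induction_on with
    | _ n ih =>
      intro hn
      rcases hn.eq_or_lt with rfl | hlt
      · have : 0 ≤ l / √u := by positivity
        linarith [hy0 u hvu le_rfl]
      obtain ⟨n, rfl⟩ : ∃ r, n = r + 1 := ⟨n - 1, by omega⟩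
      have hun : u ≤ n := by omega
      have hnR : (0 : ℝ) < n := by exact_mod_cast (by omega : 0 < n)
      have hsn := Real.sqrt_pos.2 hnR
      have hΛ := hΛ1 n hun
      set τ : ℝ := 1 / (4 * Λ n) with hτ
      have hτ0 : 0 < τ := by positivity
      have hτ1 : τ ≤ 1 := by rw [hτ, div_le_one (by positivity)]; linarith
      have hln : 0 ≤ l / √n := by positivity
      have hgap : l / √n * (τ / 2) ≤ l / √n := by nlinarith
      have hlu := hsqrt n hun
      have key : ∀ j ∈ Finset.Icc 1 n, y j ≤ (2 * (l / √u) - l / √n - l / √n * (τ / 2)) +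
          (if j < v + 1 then R else 0) +
          (if (j : ℝ) ≤ n - τ * n then 0 else l / √n * (τ / 2)) := by
        intro j hj
        rw [Finset.mem_Icc] at hj
        have hjR : (0 : ℝ) < j := by exact_mod_cast (by omega : 0 < j)
        have hpos : 0 ≤ (if (j : ℝ) ≤ n - τ * n then 0 else l / √n * (τ / 2)) := by
          split_ifs <;> positivity
        by_cases hjv : j ≤ v
        · rw [if_pos (by omega)]
          linarith [hyR j hj.1 hjv]
        rw [if_neg (by omega)]
        by_cases hju : j ≤ u
        · linarith [hy0 j (by omega) hju]
        have hyj := ih j (by omega) (by omega)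
        split_ifs with hjn
        · have h1 := one_add_half_div_sqrt_le hjR hnR hτ0.le hjn
          have h2 := mul_le_mul_of_nonneg_left h1 hl
          have h3 : l * ((1 + τ / 2) / √n) = l / √n + l / √n * (τ / 2) := by ring
          have h4 : l * (1 / √j) = l / √j := by ring
          linarith
        · have h1 : √j ≤ √n := Real.sqrt_le_sqrt (by exact_mod_cast hj.2)
          have h2 : l / √n ≤ l / √j := by
            have := Real.sqrt_pos.2 hjR
            gcongr
          linarith
      have hsumle : y (n + 1) ≤ ∑ j ∈ Finset.Icc 1 n,
          (p n j * (2 * (l / √u) - l / √n - l / √n * (τ / 2)) +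
          (if j < v + 1 then Λ n / n * R else 0) +
          (if (j : ℝ) ≤ n - τ * n then 0 else Λ n / n * (l / √n * (τ / 2)))) := by
        rw [havg n hun]
        refine Finset.sum_le_sum fun j hj => ?_
        have h1 := mul_le_mul_of_nonneg_left (key j hj) (hp0 n hun j hj)
        refine h1.trans ?_
        rw [mul_add, mul_add]
        have hp := hpΛ n hun j hj
        refine add_le_add (add_le_add le_rfl ?_) ?_
        · split_ifs
          · exact mul_le_mul_of_nonneg_right hp hR
          · simp
        · split_ifs
          · simp
          · exact mul_le_mul_of_nonneg_right hp (by positivity)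
      rw [Finset.sum_add_distrib, Finset.sum_add_distrib, ← Finset.sum_mul, hsum n hun,
        one_mul] at hsumle
      have hI1 : ∑ j ∈ Finset.Icc 1 n, (if j < v + 1 then Λ n / n * R else 0) ≤
          v * (Λ n / n * R) := by
        have e : ∀ j ∈ Finset.Icc 1 n, (if j < v + 1 then Λ n / n * R else 0) =
            if j ≤ v then Λ n / n * R else 0 := by
          intro j _
          simp only [Nat.lt_succ_iff]
        rw [Finset.sum_congr rfl e, sum_Icc_indicator_le (by omega) fun _ => Λ n / n * R]
        simp
      have hI2 := sum_Icc_indicator_gt_le n (z := τ * n) (w := Λ n / n * (l / √n * (τ / 2)))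
        (by positivity) (by positivity)
      have e1 : (τ * n + 1) * (Λ n / n * (l / √n * (τ / 2))) ≤ 1 / 2 * (l / √n * (τ / 2)) := by
        rw [← mul_assoc]
        refine mul_le_mul_of_nonneg_right ?_ (by positivity)
        have : (τ * n + 1) * (Λ n / n) = τ * Λ n + Λ n / n := by field_simp
        rw [this]
        have h1 : τ * Λ n = 1 / 4 := by rw [hτ]; field_simp
        have h2 : Λ n / n ≤ 1 / 4 := by
          rw [div_le_iff₀ hnR]; linarith [hΛ4 n hun]
        linarith
      have e2 : v * (Λ n / n * R) ≤ 1 / 2 * (l / √n * (τ / 2)) := by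
        have h1 := hbar n hun
        have h2 : v * (Λ n / n * R) = (16 * (R * v * Λ n ^ 2)) / (16 * Λ n * n) := by
          field_simp
        have h3 : 1 / 2 * (l / √n * (τ / 2)) = (l * √n) / (16 * Λ n * n) := by
          rw [hτ]
          have : (n : ℝ) = √n * √n := (Real.mul_self_sqrt hnR.le).symm
          rw [show 16 * Λ n * (n : ℝ) = 16 * Λ n * (√n * √n) by rw [← this]]
          field_simp
          ring
        rw [h2, h3]
        gcongr
      have e3 : l / √((n + 1 : ℕ) : ℝ) ≤ l / √n := by
        have := Real.sqrt_le_sqrt (by push_cast; linarith : (n : ℝ) ≤ ((n + 1 : ℕ) : ℝ))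
        gcongr
      linarith
  intro n hn
  have h1 := main n hn
  have h2 : 0 ≤ l / √n := by positivity
  rw [mul_div_assoc]
  linarith

theorem one_le_of_sum_eq_one {n : ℕ} (hn : 1 ≤ n) {w : ℕ → ℝ} {Λ : ℝ}
    (hs : ∑ j ∈ Finset.Icc 1 n, w j = 1) (h : ∀ j ∈ Finset.Icc 1 n, w j ≤ Λ / n) : 1 ≤ Λ := by
  have h1 := Finset.sum_le_sum h
  have hn' : (n : ℝ) ≠ 0 := by exact_mod_cast (by omega : n ≠ 0)
  rw [hs, Finset.sum_const, Nat.card_Icc, nsmul_eq_mul, Nat.add_sub_cancel,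
    mul_div_cancel₀ _ hn'] at h1
  exact h1

theorem le_one_of_sum_eq_one {n : ℕ} (hn : 1 ≤ n) {w : ℕ → ℝ} {c : ℝ}
    (hs : ∑ j ∈ Finset.Icc 1 n, w j = 1) (h : ∀ j ∈ Finset.Icc 1 n, c / n ≤ w j) : c ≤ 1 := by
  have h1 := Finset.sum_le_sum h
  have hn' : (n : ℝ) ≠ 0 := by exact_mod_cast (by omega : n ≠ 0)
  rw [hs, Finset.sum_const, Nat.card_Icc, nsmul_eq_mul, Nat.add_sub_cancel,
    mul_div_cancel₀ _ hn'] at h1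
  exact h1

/-- Both sides are `2 * m`-th powers of `log z / z ^ (1 / (4 * m))`, which decreases beyond `exp (4
* m)`. -/
theorem log_pow_div_sqrt_le {m : ℕ} (hm : 1 ≤ m) {u n : ℝ} (hu : Real.exp (4 * m) ≤ u)
    (hun : u ≤ n) :
    (Real.log n ^ m) ^ 2 / √n ≤ (Real.log u ^ m) ^ 2 / √u := by
  have hm' : (0 : ℝ) < m := by exact_mod_cast hm
  have ha : (0 : ℝ) < 1 / (4 * m) := by positivity
  have h := Real.log_div_self_rpow_antitoneOn ha
    (show u ∈ Set.Ici (Real.exp (1 / (4 * m) : ℝ)⁻¹) by simpa using hu)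
    (show n ∈ Set.Ici (Real.exp (1 / (4 * m) : ℝ)⁻¹) by simpa using hu.trans hun) hun
  have hu0 : 0 < u := (Real.exp_pos _).trans_le hu
  have hu1 : 1 ≤ u := (Real.one_le_exp (by positivity)).trans hu
  have e : ∀ z : ℝ, 1 ≤ z →
      (Real.log z / z ^ (1 / (4 * m) : ℝ)) ^ (2 * m) = (Real.log z ^ m) ^ 2 / √z := by
    intro z hz
    rw [div_pow, ← Real.rpow_natCast (z ^ (1 / (4 * m) : ℝ)), ← Real.rpow_mul (by linarith),
      Real.sqrt_eq_rpow, ← pow_mul, mul_comm m 2]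
    congr 2
    push_cast
    field_simp
    norm_num
  rw [← e u hu1, ← e n (hu1.trans hun)]
  have : 0 ≤ Real.log n / n ^ (1 / (4 * m) : ℝ) :=
    div_nonneg (Real.log_nonneg (hu1.trans hun)) (Real.rpow_nonneg (by linarith) _)
  exact pow_le_pow_left₀ this h _

theorem le_of_nonpos_stretch_log {p : ℕ → ℕ → ℝ} {y : ℕ → ℝ} {v u m : ℕ} {R B : ℝ}
    (hR : 0 ≤ R) (hB : 0 < B) (hm : 1 ≤ m) (hu : Real.exp (4 * m) ≤ u)
    (hsum : ∀ n, u ≤ n → ∑ j ∈ Finset.Icc 1 n, p n j = 1)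
    (hp0 : ∀ n, u ≤ n → ∀ j ∈ Finset.Icc 1 n, 0 ≤ p n j)
    (hpΛ : ∀ n, u ≤ n → ∀ j ∈ Finset.Icc 1 n, p n j ≤ B * Real.log n ^ m / n)
    (havg : ∀ n, u ≤ n → y (n + 1) = ∑ j ∈ Finset.Icc 1 n, p n j * y j)
    (hΛ4 : ∀ n : ℕ, u ≤ n → 4 * (B * Real.log n ^ m) ≤ n)
    (hy0 : ∀ j, v < j → j ≤ u → y j ≤ 0) (hyR : ∀ j, 1 ≤ j → j ≤ v → y j ≤ R)
    (hvu : v < u) :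
    ∀ n, u ≤ n → y n ≤ 32 * R * (v / u) * B ^ 2 * (Real.log u ^ m) ^ 2 := by
  have huR : (0 : ℝ) < u := (Real.exp_pos _).trans_le hu
  have hu1 : 1 ≤ u := by exact_mod_cast huR
  have hsu := Real.sqrt_pos.2 huR
  intro n hn
  -- This `l` gives equality in the barrier condition at `n = u`; monotonicity of `(log n) ^ (2 * m)
  -- / √n` gives it afterwards.
  have h := le_of_nonpos_stretch (Λ := fun n => B * Real.log n ^ m)
    (l := 16 * R * v * B ^ 2 * ((Real.log u ^ m) ^ 2 / √u)) hu1 hR (by positivity) hsum hp0 hpΛ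
    havg (fun n hn => one_le_of_sum_eq_one (by omega) (hsum n hn) (hpΛ n hn)) hΛ4 hy0 hyR ?_ hvu
    n hn
  · refine h.trans_eq ?_
    have : (u : ℝ) = √u * √u := (Real.mul_self_sqrt huR.le).symm
    have e : 32 * R * (v / (u : ℝ)) * B ^ 2 * (Real.log u ^ m) ^ 2 =
        32 * R * v * B ^ 2 * (Real.log u ^ m) ^ 2 / u := by ring
    rw [e]
    conv_rhs => rw [this]
    rw [show Real.log (√(u : ℝ) * √(u : ℝ)) = Real.log u by rw [← this]]
    field_simp
    ring
  · intro n hn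
    have hnu : (u : ℝ) ≤ n := by exact_mod_cast hn
    have h1 := log_pow_div_sqrt_le hm hu hnu
    have hsn := Real.sqrt_pos.2 (huR.trans_le hnu)
    have h2 : 16 * R * v * B ^ 2 * ((Real.log n ^ m) ^ 2 / √n) * √n ≤
        16 * R * v * B ^ 2 * ((Real.log u ^ m) ^ 2 / √u) * √n := by gcongr
    refine le_trans (le_of_eq ?_) h2
    field_simp

/-! ### Oscillation drop over one window, and convergence -/

/-- The scale of one window: `q` is about a power of `T = log N`. -/
theorem window_ratio_bounds {T : ℝ} {m : ℕ} (hT : 2 ≤ T) {q : ℕ} (hq : q = ⌈T ^ (2 * m + 2)⌉₊) :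
    T ^ (2 * m + 2) ≤ q ∧ Real.log q ≤ (2 * m + 3) * Real.log T := by
  have h1 : T ^ (2 * m + 2) ≤ q := hq ▸ Nat.le_ceil _
  refine ⟨h1, ?_⟩
  have hpos : 0 < T ^ (2 * m + 2) := by positivity
  have h2 : (q : ℝ) ≤ T ^ (2 * m + 3) := by
    have h3 := (Nat.ceil_lt_add_one hpos.le).le
    rw [← hq] at h3
    have h4 : 1 ≤ T ^ (2 * m + 2) := one_le_pow₀ (by linarith)
    have h5 : T ^ (2 * m + 3) = T * T ^ (2 * m + 2) := by ring
    nlinarith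
  have h3 := Real.log_le_log (hpos.trans_le h1) h2
  rw [Real.log_pow] at h3
  push_cast at h3
  exact h3

theorem log_log_sub_le {T S : ℝ} (hT : 1 < T) (hS : T ≤ S) :
    Real.log (Real.log S) - Real.log (Real.log T) ≤ (S - T) / (T * Real.log T) := by
  have hl : 0 < Real.log T := Real.log_pos hT
  have hlS : 0 < Real.log S := Real.log_pos (by linarith)
  have key : ∀ {a b : ℝ}, 0 < a → 0 < b → Real.log b - Real.log a ≤ (b - a) / a := by
    intro a b ha hb
    rw [← Real.log_div hb.ne' ha.ne']
    have := Real.log_le_sub_one_of_pos (div_pos hb ha)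
    rwa [sub_div, div_self ha.ne']
  have h1 := key hl hlS
  have h2 := key (by linarith : 0 < T) (by linarith : 0 < S)
  have h3 : (Real.log S - Real.log T) / Real.log T ≤ (S - T) / T / Real.log T := by gcongr
  rw [div_div] at h3
  linarith

theorem abs_le_of_averaging {A B α β : ℝ} {k : ℕ} {p : ℕ → ℕ → ℝ} {a : ℕ → ℝ} (hk : 1 ≤ k)
    (hp : IsAdmissible A B α β k p)
    (ha : ∀ n, k ≤ n → a (n + 1) = ∑ j ∈ Finset.Icc 1 n, p n j * a j) :
    ∃ C : ℝ, 0 < C ∧ ∀ j, 1 ≤ j → |a j| ≤ C := by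
  refine ⟨∑ j ∈ Finset.Icc 1 k, |a j| + 1, by positivity, fun j => ?_⟩
  induction j using Nat.strong_induction_on with
  | _ j ih =>
    intro hj
    rcases le_or_gt j k with h | h
    · have := Finset.single_le_sum (f := fun j => |a j|) (s := Finset.Icc 1 k)
        (fun i _ => abs_nonneg _) (Finset.mem_Icc.2 ⟨hj, h⟩)
      linarith
    · obtain ⟨n, rfl⟩ : ∃ r, j = r + 1 := ⟨j - 1, by omega⟩
      have hP := hp.prob n (by omega)
      rw [ha n (by omega)]
      refine (Finset.abs_sum_le_sum_abs _ _).trans ?_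
      have : ∀ i ∈ Finset.Icc 1 n, |p n i * a i| ≤ p n i * (∑ j ∈ Finset.Icc 1 k, |a j| + 1) := by
        intro i hi
        rw [abs_mul, abs_of_nonneg (hP.1 i hi)]
        rw [Finset.mem_Icc] at hi
        exact mul_le_mul_of_nonneg_left (ih i (by omega) hi.1)
          (hP.1 i (Finset.mem_Icc.2 hi))
      refine (Finset.sum_le_sum this).trans ?_
      rw [← Finset.sum_mul, hP.2, one_mul]

/-- The normalisation measures distance from the top `M` in units of `M - I`. Two terms differ by at
most `2 * C` and `M - I ≥ D`, so early terms overshoot `[0, 1]` by at most `2 * C / D`. -/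
theorem averagingWindow_of_isAdmissible {A B α β C D M I T : ℝ} (hA : 0 < A) (hB : 0 < B)
    (hα : 0 ≤ α) (hβ : 0 ≤ β) {k : ℕ} {p : ℕ → ℕ → ℝ} {a : ℕ → ℝ}
    (hp : IsAdmissible A B α β k p)
    (ha : ∀ n, k ≤ n → a (n + 1) = ∑ j ∈ Finset.Icc 1 n, p n j * a j) (hC0 : 0 < C)
    (hC : ∀ j, 1 ≤ j → |a j| ≤ C) (hD : 0 < D) {N L : ℕ} (hkN : k ≤ N) (hN : 2 ≤ N)
    (hb : ∀ j, N ≤ j → I ≤ a j ∧ a j ≤ M) (hMI : D ≤ M - I)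
    (hL : ∀ n : ℕ, 2 ≤ n → n ≤ L → Real.log n ≤ T) :
    AveragingWindow p (fun j => (M - a j) / (M - I)) N L (A * T ^ (-α)) (B * T ^ β)
      (2 * C / D) where
  sum_eq_one n h1 _ := (hp.prob n (by omega)).2
  floor n h1 h2 j hj := by
    refine le_trans ?_ (hp.floor n (by omega) (by omega) j hj)
    have hl : 0 < Real.log n := Real.log_pos (by exact_mod_cast (by omega : 1 < n))
    have := Real.rpow_le_rpow_of_nonpos hl (hL n (by omega) h2) (neg_nonpos.2 hα)
    gcongr
  ceiling n h1 h2 j hj := by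
    refine (hp.ceiling n (by omega) (by omega) j hj).trans ?_
    have hl : 0 < Real.log n := Real.log_pos (by exact_mod_cast (by omega : 1 < n))
    have := Real.rpow_le_rpow hl.le (hL n (by omega) h2) hβ
    gcongr
  average n h1 h2 := by
    have hs := (hp.prob n (by omega)).2
    simp only [mul_div_assoc', ← Finset.sum_div, mul_sub, Finset.sum_sub_distrib,
      ← Finset.sum_mul]
    rw [hs, one_mul, ha n (by omega)]
  nonneg j hj := div_nonneg (by linarith [hb j hj]) (by linarith)
  le_one j hj := by
    rw [div_le_one (by linarith)]
    linarith [hb j hj]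
  lower j hj := by
    have hE : 0 < M - I := by linarith
    have h1 := abs_le.1 (hC j hj)
    have h2 := abs_le.1 (hC N (by omega))
    have h3 := hb N le_rfl
    have h4 : 2 * C ≤ 2 * C / D * (M - I) := by
      rw [div_mul_eq_mul_div, le_div_iff₀ hD]
      gcongr
    rw [le_div_iff₀ hE]
    linarith
  upper j hj := by
    have hE : 0 < M - I := by linarith
    have h1 := abs_le.1 (hC j hj)
    have h2 := abs_le.1 (hC N (by omega))
    have h3 := hb N le_rfl
    have h4 : 2 * C ≤ 2 * C / D * (M - I) := by
      rw [div_mul_eq_mul_div, le_div_iff₀ hD]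
      gcongr
    rw [div_le_iff₀ hE, add_mul]
    linarith

/-- The floor constant times the square root of the reciprocal ceiling constant is of order at
least `1 / T` when `α + β / 2 ≤ 1`. -/
theorem floor_mul_inv_sqrt_ceiling_ge {A B α β T : ℝ} (hA : 0 < A) (hB : 0 < B)
    (hαβ : α + β / 2 ≤ 1) (hT : 1 ≤ T) :
    A / (20 * √B) / T ≤ A * (2 * T) ^ (-α) * (1 / (10 * √(B * (2 * T) ^ β))) := by
  have hT0 : 0 < 2 * T := by linarith
  have e : √(B * (2 * T) ^ β) = √B * (2 * T) ^ (β / 2) := by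
    rw [Real.sqrt_mul hB.le, Real.sqrt_eq_rpow ((2 * T) ^ β), ← Real.rpow_mul hT0.le]
    congr 2
    ring
  rw [e, Real.rpow_neg hT0.le]
  have h1 : (2 * T) ^ α * (2 * T) ^ (β / 2) ≤ 2 * T := by
    rw [← Real.rpow_add hT0]
    exact (Real.rpow_le_rpow_of_exponent_le (by linarith) hαβ).trans_eq (Real.rpow_one _)
  have h2 : 0 < (2 * T) ^ α := Real.rpow_pos_of_pos hT0 _
  have h3 : 0 < (2 * T) ^ (β / 2) := Real.rpow_pos_of_pos hT0 _
  have h4 : 0 < √B := Real.sqrt_pos.2 hB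
  have e1 : A / (20 * √B) / T = A / (10 * √B * (2 * T)) := by
    field_simp
    norm_num
  have e2 : A * ((2 * T) ^ α)⁻¹ * (1 / (10 * (√B * (2 * T) ^ (β / 2)))) =
      A / (10 * √B * ((2 * T) ^ α * (2 * T) ^ (β / 2))) := by
    field_simp
  rw [e1, e2]
  gcongr

set_option maxHeartbeats 1600000 in
/-- Over one window the oscillation of the sequence drops by an amount comparable to the growth of
the triple logarithm. -/
theorem exists_oscillation_drop {A B α β C D : ℝ} (hA : 0 < A) (hB : 0 < B)
    (hα : 0 ≤ α) (hβ : 0 ≤ β) (hαβ : α + β / 2 ≤ 1) {k : ℕ} (hk : 1 ≤ k) {p : ℕ → ℕ → ℝ} {a : ℕ → ℝ}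
    (hp : IsAdmissible A B α β k p)
    (ha : ∀ n, k ≤ n → a (n + 1) = ∑ j ∈ Finset.Icc 1 n, p n j * a j) (hC0 : 0 < C)
    (hC : ∀ j, 1 ≤ j → |a j| ≤ C) (hD : 0 < D) :
    ∃ κ : ℝ, 0 < κ ∧ ∃ N₀ : ℕ, ∀ N : ℕ, N₀ ≤ N → ∀ M I : ℝ, (∀ j, N ≤ j → I ≤ a j ∧ a j ≤ M) →
      D ≤ M - I → ∃ N' : ℕ, N < N' ∧ ∃ M' I' : ℝ, (∀ j, N' ≤ j → I' ≤ a j ∧ a j ≤ M') ∧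
        M' - I' + κ * Real.log (Real.log (Real.log N')) ≤
          M - I + κ * Real.log (Real.log (Real.log N)) := by
  -- An integer exponent `m ≥ 1` above `β`; the crude ceiling `B (log n) ^ m` is enough for
  -- everything except the size of `c * δ`.
  set m : ℕ := ⌈β⌉₊ + 1 with hm
  have hβm : β ≤ m := by
    have := Nat.le_ceil β
    push_cast [hm]
    linarith
  have hm1 : 1 ≤ m := by omega
  set κ₀ : ℝ := A / (20 * √B) with hκ₀
  have hsB : 0 < √B := Real.sqrt_pos.2 hB
  have hκ₀0 : 0 < κ₀ := by positivity
  set R : ℝ := 2 * C / D with hR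
  have hR0 : 0 < R := by positivity
  set K : ℝ := 2 * m + 3 with hK
  have hK0 : 0 < K := by positivity
  have hTlim : Filter.Tendsto (fun N : ℕ => Real.log (N : ℝ)) Filter.atTop Filter.atTop :=
    Real.tendsto_log_atTop.comp tendsto_natCast_atTop_atTop
  have ev1 := hTlim.eventually_ge_atTop (1000 + 4 * m + 1000 * R * B * 2 ^ m / κ₀ +
    512 * (1 + R) * B ^ 2 * 4 ^ m / κ₀)
  have ev2 : ∀ᶠ N : ℕ in Filter.atTop, Real.log (Real.log N) ≤ 1 / (3 * K) * Real.log N := by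
    have h1 := Real.isLittleO_log_id_atTop.bound (by positivity : 0 < 1 / (3 * K))
    filter_upwards [hTlim.eventually h1, hTlim.eventually_ge_atTop 1] with N h2 h3
    simp only [id, Real.norm_eq_abs] at h2
    rw [abs_of_nonneg (by linarith : 0 ≤ Real.log (N : ℝ))] at h2
    exact (le_abs_self _).trans h2
  have ev3 : ∀ᶠ N : ℕ in Filter.atTop, ∀ n, N ≤ n → 4 * (B * Real.log (n : ℝ) ^ m) ≤ n := by
    rw [Filter.eventually_forall_ge_atTop]
    have h1 := (Real.isLittleO_pow_log_id_atTop (n := m)).bound (by positivity : 0 < 1 / (4 * B))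
    filter_upwards [tendsto_natCast_atTop_atTop.eventually h1] with N h2
    simp only [id, Real.norm_eq_abs, Nat.abs_cast] at h2
    have h3 := (le_abs_self _).trans h2
    rw [div_mul_eq_mul_div, le_div_iff₀ (by positivity)] at h3
    linarith
  obtain ⟨N₀, hN₀⟩ := Filter.eventually_atTop.1
    ((ev1.and ev2).and (ev3.and (Filter.eventually_ge_atTop (max k 2))))
  -- The triple logarithm grows by at most `3 * K / T` and the oscillation drops by at least `D * κ₀
  -- / (16 * T)`; hence `48 = 3 * 16`.
  refine ⟨D * κ₀ / (48 * K), by positivity, N₀, fun N hN M I hb hMI => ?_⟩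
  obtain ⟨⟨h1, h2⟩, h3, h4⟩ := hN₀ N hN
  have hkN : k ≤ N := (le_max_left _ _).trans h4
  have hN2 : 2 ≤ N := (le_max_right _ _).trans h4
  clear hN₀ ev1 ev2 ev3
  set T : ℝ := Real.log N with hT
  have hq1 : 0 ≤ 1000 * R * B * 2 ^ m / κ₀ := by positivity
  have hq2 : 0 ≤ 512 * (1 + R) * B ^ 2 * 4 ^ m / κ₀ := by positivity
  have hm0 : (0 : ℝ) ≤ m := by positivity
  have hT1000 : 1000 ≤ T := by linarith
  have hT4m : 4 * m ≤ T := by linarith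
  have hTR : 1000 * R * B * 2 ^ m ≤ κ₀ * T := by
    rw [← div_le_iff₀' hκ₀0]; linarith
  have hTR' : 512 * (1 + R) * B ^ 2 * 4 ^ m ≤ κ₀ * T := by
    rw [← div_le_iff₀' hκ₀0]; linarith
  obtain ⟨q, hq⟩ : ∃ q : ℕ, q = ⌈T ^ (2 * m + 2)⌉₊ := ⟨_, rfl⟩
  obtain ⟨hqT, hqlog⟩ := window_ratio_bounds (by linarith) hq
  have hTq : T ≤ q := (le_self_pow₀ (by linarith) (by omega)).trans hqT
  have hq1000 : 1000 ≤ q := by exact_mod_cast hT1000.trans hTq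
  have hNR : (0 : ℝ) < N := by exact_mod_cast (by omega : 0 < N)
  have hqR : (0 : ℝ) < q := by linarith
  set L : ℕ := N * q ^ 3 with hL
  have hLlog : Real.log L = T + 3 * Real.log q := by
    rw [hL]
    push_cast
    rw [Real.log_mul hNR.ne' (by positivity), Real.log_pow]
    norm_num [hT]
  have hlogT : 0 < Real.log T := Real.log_pos (by linarith)
  have hqlog0 : 0 ≤ Real.log q := Real.log_nonneg (by linarith)
  have h2T : Real.log L ≤ 2 * T := by
    rw [hLlog]
    have : K * Real.log T ≤ K * (1 / (3 * K) * T) := by gcongr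
    have e : K * (1 / (3 * K) * T) = T / 3 := by field_simp
    linarith
  have hlogle : ∀ n : ℕ, 2 ≤ n → n ≤ L → Real.log n ≤ 2 * T := by
    intro n hn hnL
    refine (Real.log_le_log (by positivity) ?_).trans h2T
    exact_mod_cast hnL
  have hNL : N < L := by
    rw [hL]
    have : 1 < q ^ 3 := Nat.one_lt_pow (by omega) (by omega)
    exact lt_mul_of_one_lt_right (by omega) this
  have W := averagingWindow_of_isAdmissible hA hB hα hβ hp ha hC0 hC hD hkN hN2 hb hMI hlogle
  rw [← hR] at W
  set c : ℝ := A * (2 * T) ^ (-α) with hc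
  set Λ : ℝ := B * (2 * T) ^ β with hΛ
  set δ : ℝ := 1 / (10 * √Λ) with hδ
  have h2T0 : 0 < 2 * T := by linarith
  have hc0 : 0 < c := mul_pos hA (Real.rpow_pos_of_pos h2T0 _)
  have hΛ0 : 0 < Λ := mul_pos hB (Real.rpow_pos_of_pos h2T0 _)
  have hsΛ : 0 < √Λ := Real.sqrt_pos.2 hΛ0
  have hδ0 : 0 < δ := by positivity
  have hcδ : κ₀ / T ≤ c * δ := floor_mul_inv_sqrt_ceiling_ge hA hB hαβ (by linarith)
  have hc1 : c ≤ 1 := le_one_of_sum_eq_one (by omega) (W.sum_eq_one N le_rfl hNL.le)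
    (W.floor N le_rfl hNL.le)
  have hΛ1 : 1 ≤ Λ := one_le_of_sum_eq_one (by omega) (W.sum_eq_one N le_rfl hNL.le)
    (W.ceiling N le_rfl hNL.le)
  have hδΛ : 100 * δ ^ 2 * Λ ≤ 1 := by
    have : Λ = √Λ * √Λ := (Real.mul_self_sqrt hΛ0.le).symm
    rw [hδ]
    conv_lhs => rw [this]
    rw [show √(√Λ * √Λ) = √Λ by rw [← this]]
    apply le_of_eq
    field_simp
    norm_num
  have hcδ1 : c * δ ≤ 1 := by
    have h1 : δ ^ 2 ≤ δ ^ 2 * Λ := le_mul_of_one_le_right (by positivity) hΛ1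
    have h2 : δ ≤ 1 := by
      rw [← abs_of_pos hδ0]
      exact (sq_le_one_iff_abs_le_one _).1 (by linarith)
    exact mul_le_one₀ hc1 hδ0.le h2
  have hΛm : Λ ≤ B * (2 * T) ^ m := by
    rw [hΛ, ← Real.rpow_natCast]
    have := Real.rpow_le_rpow_of_exponent_le (by linarith : 1 ≤ 2 * T) hβm
    gcongr
  have hsmall : 1000 * (R * Λ) ≤ c * δ * q := by
    have e1 : 1000 * (R * Λ) ≤ 1000 * (R * (B * (2 * T) ^ m)) := by gcongr
    have e2 : 1000 * (R * (B * (2 * T) ^ m)) = (1000 * R * B * 2 ^ m) * T ^ m := by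
      rw [mul_pow]; ring
    have e3 : (1000 * R * B * 2 ^ m) * T ^ m ≤ κ₀ * T * T ^ m := by gcongr
    have e4 : κ₀ * T * T ^ m ≤ κ₀ * T ^ (2 * m + 1) := by
      rw [mul_assoc, ← pow_succ']
      have := pow_le_pow_right₀ (by linarith : 1 ≤ T) (by omega : m + 1 ≤ 2 * m + 1)
      gcongr
    have e5 : κ₀ * T ^ (2 * m + 1) = κ₀ / T * T ^ (2 * m + 2) := by
      field_simp
      ring
    have e6 : κ₀ / T * T ^ (2 * m + 2) ≤ c * δ * q := by gcongr
    linarith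
  obtain ⟨v, u, hNv, hvqu, huL, hgap⟩ :=
    W.exists_gap (by omega) hc0 hc1 hΛ1 hR0.le hδ0 hδΛ hq1000 hsmall hL
  have hv0 : 0 < v := by omega
  have hvu : v < u := (lt_mul_of_one_lt_right hv0 (by omega : 1 < q)).trans_le hvqu
  have hNu : N ≤ u := by omega
  have hu0 : (0 : ℝ) < u := by exact_mod_cast (by omega : 0 < u)
  have hvuq : (v : ℝ) / u ≤ 1 / q := by
    rw [div_le_div_iff₀ hu0 hqR, one_mul]
    exact_mod_cast hvqu
  have hexpu : Real.exp (4 * m) ≤ u := by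
    have : Real.exp (4 * m) ≤ N := (Real.le_log_iff_exp_le hNR).1 hT4m
    exact this.trans (by exact_mod_cast hNu)
  have hlogu0 : 0 ≤ Real.log u := Real.log_nonneg (by exact_mod_cast (by omega : 1 ≤ u))
  have hlogu : Real.log u ≤ 2 * T := hlogle u (by omega) huL
  -- The ratio `q ≥ T ^ (2 * m + 2)` beats `(log u) ^ (2 * m)` by `T ^ 2`, so the persistence error
  -- is `O(1 / T ^ 2)`, below half of a gap of order at least `1 / T`.
  have herr : 32 * (1 + R) * ((v : ℝ) / u) * B ^ 2 * (Real.log u ^ m) ^ 2 ≤ c * δ / 16 := by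
    have e1 : 32 * (1 + R) * ((v : ℝ) / u) * B ^ 2 * (Real.log u ^ m) ^ 2 ≤
        32 * (1 + R) * (1 / T ^ (2 * m + 2)) * B ^ 2 * ((2 * T) ^ m) ^ 2 := by
      have : 1 / (q : ℝ) ≤ 1 / T ^ (2 * m + 2) := by
        apply one_div_le_one_div_of_le _ hqT
        positivity
      have h5 := hvuq.trans this
      gcongr
    have e2 : 32 * (1 + R) * (1 / T ^ (2 * m + 2)) * B ^ 2 * ((2 * T) ^ m) ^ 2 =
        (512 * (1 + R) * B ^ 2 * 4 ^ m) / (16 * T ^ 2) := by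
      rw [mul_pow, show (4 : ℝ) = 2 ^ 2 by norm_num, ← pow_mul, mul_pow, ← pow_mul, ← pow_mul,
        pow_add, mul_comm m 2]
      field_simp
      ring
    have e3 : (512 * (1 + R) * B ^ 2 * 4 ^ m) / (16 * T ^ 2) ≤ κ₀ * T / (16 * T ^ 2) := by gcongr
    have e4 : κ₀ * T / (16 * T ^ 2) = κ₀ / T / 16 := by field_simp
    linarith
  -- The barrier is applied to the deficit `c * δ / 8 - y`, nonpositive on the stretch and at most
  -- `1 + R` before it.
  have persist : ∀ {y : ℕ → ℝ}, (∀ n, k ≤ n → y (n + 1) = ∑ j ∈ Finset.Icc 1 n, p n j * y j) →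
      (∀ j, 1 ≤ j → -R ≤ y j) → (∀ n, v < n → n ≤ u → c * δ / 8 ≤ y n) →
      ∀ n, u ≤ n → κ₀ / T / 16 ≤ y n := by
    intro y hy hyR hyg n hn
    have hlow := le_of_nonpos_stretch_log (p := p) (y := fun j => c * δ / 8 - y j) (v := v)
      (u := u) (m := m) (R := 1 + R) (B := B) (by linarith) hB hm1 hexpu
      (fun n hn => (hp.prob n (by omega)).2) (fun n hn => (hp.prob n (by omega)).1)
      (fun n hn j hj => ?_) (fun n hn => ?_) (fun n hn => h3 n (by omega))
      (fun j h1 h2 => by linarith [hyg j h1 h2]) (fun j h1 h2 => by linarith [hyR j h1]) hvu n hn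
    · linarith
    · refine (hp.ceiling n (by omega) (by omega) j hj).trans ?_
      have hl : T ≤ Real.log n := Real.log_le_log hNR (by exact_mod_cast hNu.trans hn)
      have := Real.rpow_le_rpow_of_exponent_le (by linarith : 1 ≤ Real.log n) hβm
      rw [Real.rpow_natCast] at this
      gcongr
    · simp only [mul_sub, Finset.sum_sub_distrib, ← Finset.sum_mul]
      rw [(hp.prob n (by omega)).2, hy n (by omega), one_mul]
  have hgrow : D * κ₀ / (48 * K) * Real.log (Real.log (Real.log L)) ≤
      D * κ₀ / (48 * K) * Real.log (Real.log T) + D * (κ₀ / T / 16) := by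
    have e1 := log_log_sub_le (T := T) (S := Real.log L) (by linarith) (by linarith)
    have e2 : (Real.log L - T) / (T * Real.log T) ≤ 3 * K / T := by
      rw [div_le_div_iff₀ (by positivity) (by positivity), hLlog]
      have : 3 * Real.log q * T ≤ 3 * (K * Real.log T) * T := by gcongr
      linarith
    have e3 : D * κ₀ / (48 * K) * (Real.log (Real.log (Real.log L)) - Real.log (Real.log T)) ≤
        D * κ₀ / (48 * K) * (3 * K / T) := by
      apply mul_le_mul_of_nonneg_left (e1.trans e2)
      positivity
    have e4 : D * κ₀ / (48 * K) * (3 * K / T) = D * (κ₀ / T / 16) := by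
      field_simp
      norm_num
    linarith
  have hE : 0 < M - I := by linarith
  have hκT : 0 ≤ κ₀ / T / 16 := by positivity
  have hDE : D * (κ₀ / T / 16) ≤ κ₀ / T / 16 * (M - I) := by
    rw [mul_comm]; gcongr
  have havgx : ∀ n, k ≤ n → (M - a (n + 1)) / (M - I) =
      ∑ j ∈ Finset.Icc 1 n, p n j * ((M - a j) / (M - I)) := by
    intro n hn
    simp only [mul_div_assoc', ← Finset.sum_div, mul_sub, Finset.sum_sub_distrib,
      ← Finset.sum_mul]
    rw [(hp.prob n (by omega)).2, one_mul, ha n (by omega)]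
  refine ⟨L, hNL, ?_⟩
  rcases hgap with hgap | hgap
  · refine ⟨M - κ₀ / T / 16 * (M - I), I, fun j hj => ⟨(hb j (by omega)).1, ?_⟩, by linarith⟩
    have := persist havgx W.lower hgap j (by omega)
    rw [le_div_iff₀ hE] at this
    linarith
  · refine ⟨M, I + κ₀ / T / 16 * (M - I), fun j hj => ⟨?_, (hb j (by omega)).2⟩, by linarith⟩
    have := persist (y := fun j => 1 - (M - a j) / (M - I)) (fun n hn => ?_) W.reflect.lower
      hgap j (by omega)
    · have h5 : (M - a j) / (M - I) ≤ 1 - κ₀ / T / 16 := by linarith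
      rw [div_le_iff₀ hE] at h5
      linarith
    · simp only [mul_sub, mul_one, Finset.sum_sub_distrib]
      rw [(hp.prob n (by omega)).2, havgx n hn]

theorem exists_tendsto_of_averaging {A B α β : ℝ} (hA : 0 < A) (hB : 0 < B)
    (hα : 0 ≤ α) (hβ : 0 ≤ β) (hαβ : α + β / 2 ≤ 1) {k : ℕ} (hk : 1 ≤ k) {p : ℕ → ℕ → ℝ}
    {a : ℕ → ℝ} (hp : IsAdmissible A B α β k p)
    (ha : ∀ n, k ≤ n → a (n + 1) = ∑ j ∈ Finset.Icc 1 n, p n j * a j) :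
    ∃ l : ℝ, Filter.Tendsto a Filter.atTop (nhds l) := by
  obtain ⟨C, hC0, hC⟩ := abs_le_of_averaging hk hp ha
  apply cauchySeq_tendsto_of_complete
  rw [Metric.cauchySeq_iff]
  by_contra hnot
  push Not at hnot
  obtain ⟨D, hD, hosc⟩ := hnot
  have hMI : ∀ N (M I : ℝ), (∀ j, N ≤ j → I ≤ a j ∧ a j ≤ M) → D ≤ M - I := by
    intro N M I h
    obtain ⟨i, hi, j, hj, hij⟩ := hosc N
    refine hij.trans ?_
    rw [Real.dist_eq, abs_le]
    constructor <;> linarith [h i hi, h j hj]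
  obtain ⟨κ, hκ, N₀, hstep⟩ := exists_oscillation_drop hA hB hα hβ hαβ hk hp ha hC0 hC hD
  set g : ℕ → ℝ := fun N => Real.log (Real.log (Real.log N)) with hg
  have hglim : Filter.Tendsto g Filter.atTop Filter.atTop :=
    Real.tendsto_log_atTop.comp (Real.tendsto_log_atTop.comp
      (Real.tendsto_log_atTop.comp tendsto_natCast_atTop_atTop))
  set N₁ := max N₀ 1 with hN₁
  have hunb : ∀ i : ℕ, ∃ N, N₁ + i ≤ N ∧ ∃ M I : ℝ, (∀ j, N ≤ j → I ≤ a j ∧ a j ≤ M) ∧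
      M - I + κ * g N ≤ C - -C + κ * g N₁ := by
    intro i
    induction i with
    | zero =>
      exact ⟨N₁, by omega, C, -C, fun j hj => abs_le.1 (hC j (by omega)), le_rfl⟩
    | succ i ih =>
      obtain ⟨N, hN, M, I, hb, hle⟩ := ih
      obtain ⟨N', hN', M', I', hb', hle'⟩ := hstep N (by omega) M I hb (hMI N M I hb)
      exact ⟨N', by omega, M', I', hb', hle'.trans hle⟩
  obtain ⟨i, hi⟩ := Filter.eventually_atTop.1
    (hglim.eventually_gt_atTop ((C - -C + κ * g N₁) / κ))
  obtain ⟨N, hN, M, I, hb, hle⟩ := hunb i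
  have h1 := hi N (by omega)
  rw [div_lt_iff₀ hκ] at h1
  linarith [hMI N M I hb]

theorem sequenceConverges_of_averaging {A B α β : ℝ} (hA : 0 < A) (hB : 0 < B)
    (hα : 0 ≤ α) (hβ : 0 ≤ β) (hαβ : α + β / 2 ≤ 1) {d k : ℕ} (hk : 1 ≤ k) {p : ℕ → ℕ → ℝ}
    (hp : IsAdmissible A B α β k p) {a : ℕ → EuclideanSpace ℝ (Fin d)}
    (ha : IsAveragingSequence k p a) : SequenceConverges a := by
  have hcoord : ∀ i : Fin d, ∃ l : ℝ, Filter.Tendsto (fun n => a n i) Filter.atTop (nhds l) := by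
    intro i
    refine exists_tendsto_of_averaging hA hB hα hβ hαβ hk hp fun n hn => ?_
    rw [ha n hn]
    simp
  choose l hl using hcoord
  refine ⟨WithLp.toLp 2 l, ?_⟩
  have h1 : Filter.Tendsto (fun n => WithLp.ofLp (a n)) Filter.atTop (nhds l) :=
    tendsto_pi_nhds.2 hl
  exact ((PiLp.continuous_toLp 2 _).tendsto l).comp h1

/-! ### Oscillating averages from cyclic weights -/

/-- The sequence that agrees with `f` up to index `k` and is averaged with the weights `p` after. -/
noncomputable def averagingExtension (k : ℕ) (p : ℕ → ℕ → ℝ) (f : ℕ → ℝ) (n : ℕ) : ℝ :=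
  if n ≤ k then f n
  else ∑ j ∈ (Finset.Icc 1 (n - 1)).attach, p (n - 1) j * averagingExtension k p f j
termination_by n
decreasing_by
  have := Finset.mem_Icc.1 j.2
  omega

theorem averagingExtension_of_le {k n : ℕ} (p : ℕ → ℕ → ℝ) (f : ℕ → ℝ) (h : n ≤ k) :
    averagingExtension k p f n = f n := by
  rw [averagingExtension, if_pos h]

theorem averagingExtension_succ {k n : ℕ} (p : ℕ → ℕ → ℝ) (f : ℕ → ℝ) (h : k ≤ n) :
    averagingExtension k p f (n + 1) =
      ∑ j ∈ Finset.Icc 1 n, p n j * averagingExtension k p f j := by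
  rw [averagingExtension, if_neg (by omega)]
  exact Finset.sum_attach (Finset.Icc 1 n) fun j => p n j * averagingExtension k p f j

/-- A discrete Grönwall bound over one cycle. -/
theorem sum_le_two_mul_of_le_average {f : ℕ → ℝ} {N L : ℕ} {c : ℝ} (hN : 1 ≤ N) (hc : 0 ≤ c)
    (hf : ∀ j, 1 ≤ j → j ≤ N → f j ≤ 1)
    (hstep : ∀ n, N ≤ n → n < L → f (n + 1) ≤ c / n * ∑ j ∈ Finset.Icc 1 n, f j)
    (hL : 2 * c * (Real.log L - Real.log N) ≤ Real.log 2) :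
    ∀ n, N ≤ n → n ≤ L → ∑ j ∈ Finset.Icc 1 n, f j ≤ 2 * N := by
  have main : ∀ n, N ≤ n → n ≤ L →
      ∑ j ∈ Finset.Icc 1 n, f j ≤ N * Real.exp (2 * c * (Real.log n - Real.log N)) := by
    intro n hn
    induction n, hn using Nat.le_induction with
    | base =>
      intro _
      have := Finset.sum_le_card_nsmul (Finset.Icc 1 N) f 1 fun j hj =>
        hf j (Finset.mem_Icc.1 hj).1 (Finset.mem_Icc.1 hj).2
      simpa using this
    | succ n hn ih =>
      intro hnL
      have hn0 : (0 : ℝ) < n := by exact_mod_cast (by omega : 0 < n)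
      have hn1 : (1 : ℝ) ≤ n := by exact_mod_cast (by omega : 1 ≤ n)
      -- The factor `2` absorbs the discretisation `1 / n ≤ 2 / (n + 1)`.
      have hlog : 1 / (n : ℝ) ≤ 2 * (Real.log (n + 1) - Real.log n) := by
        have h1 := Real.one_sub_inv_le_log_of_pos (by positivity : 0 < ((n : ℝ) + 1) / n)
        rw [Real.log_div (by positivity) hn0.ne', inv_div] at h1
        have h2 : 1 / (n : ℝ) ≤ 2 * (1 - n / (n + 1)) := by
          rw [div_le_iff₀ hn0]
          field_simp
          linarith
        linarith
      have hexp : 1 + c / n ≤ Real.exp (2 * c * (Real.log (n + 1) - Real.log n)) := by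
        have h1 : c / n ≤ 2 * c * (Real.log (n + 1) - Real.log n) := by
          have := mul_le_mul_of_nonneg_left hlog hc
          have e : c / n = c * (1 / n) := by ring
          linarith
        have h2 := Real.add_one_le_exp (c / n)
        have h3 := Real.exp_le_exp.2 h1
        linarith
      rw [Finset.sum_Icc_succ_top (by omega)]
      have h4 := hstep n hn (by omega)
      have h5 := ih (by omega)
      have h6 : (1 + c / n) * ∑ j ∈ Finset.Icc 1 n, f j ≤
          (1 + c / n) * (N * Real.exp (2 * c * (Real.log n - Real.log N))) := by gcongr
      have h7 : (1 + c / n) * (N * Real.exp (2 * c * (Real.log n - Real.log N))) ≤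
          Real.exp (2 * c * (Real.log (n + 1) - Real.log n)) *
            (N * Real.exp (2 * c * (Real.log n - Real.log N))) := by gcongr
      have h8 : Real.exp (2 * c * (Real.log (n + 1) - Real.log n)) *
            (N * Real.exp (2 * c * (Real.log n - Real.log N))) =
          N * Real.exp (2 * c * (Real.log ((n + 1 : ℕ) : ℝ) - Real.log N)) := by
        rw [mul_left_comm, ← Real.exp_add]
        congr 2
        push_cast
        ring
      linarith
  intro n hn hnL
  refine (main n hn hnL).trans ?_
  rw [mul_comm]
  have h1 : Real.exp (2 * c * (Real.log n - Real.log N)) ≤ Real.exp (Real.log 2) := by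
    refine Real.exp_le_exp.2 (le_trans ?_ hL)
    have hn0 : (0 : ℝ) < n := by exact_mod_cast (by omega : 0 < n)
    have := Real.log_le_log hn0 (by exact_mod_cast hnL : (n : ℝ) ≤ L)
    gcongr
  rw [Real.exp_log (by norm_num)] at h1
  gcongr

/-- Cycle data: in the cycle `v`, which consists of the times in `[2 K v, 2 K (v + 1))`, every index
has weight at least `c v / n`, and the remaining mass is spread evenly over the block
`(K (v - 1), 2 K (v - 1)]`. -/
structure CycleData (K Q : ℕ → ℕ) (c : ℕ → ℝ) : Prop where
  pos : 1 ≤ K 0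
  succ : ∀ w, K (w + 1) = Q w * K w
  three_le : ∀ w, 3 ≤ Q w
  mono : Monotone Q
  nonneg : ∀ w, 0 ≤ c w
  le_one : ∀ w, c w ≤ 1
  log_le : ∀ w, 2 * c w * Real.log (Q w) ≤ Real.log 2
  sum_le : ∀ V, ∑ v ∈ Finset.range V, 4 * c v / Q v ≤ 1 / 4

/-- The cycle that contains the time `n`. -/
noncomputable def cycleIndex (K : ℕ → ℕ) (n : ℕ) : ℕ :=
  Nat.findGreatest (fun v => 2 * K v ≤ n) n

/-- The weights that make the averages oscillate. -/
noncomputable def cycleWeights (K : ℕ → ℕ) (c : ℕ → ℝ) (n j : ℕ) : ℝ :=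
  if n < 2 * K 1 then 1 / n
  else c (cycleIndex K n) / n +
    if j ∈ Finset.Ioc (K (cycleIndex K n - 1)) (2 * K (cycleIndex K n - 1)) then
      (1 - c (cycleIndex K n)) / K (cycleIndex K n - 1) else 0

/-- The alternating targets of the cycles. -/
noncomputable def cycleTarget (w : ℕ) : ℝ := if Even w then 1 else 0

theorem cycleTarget_add_two (w : ℕ) : cycleTarget (w + 2) = cycleTarget w := by
  simp [cycleTarget, Nat.even_add]

namespace CycleData

variable {K Q : ℕ → ℕ} {c : ℕ → ℝ}

theorem K_pos (h : CycleData K Q c) (w : ℕ) : 1 ≤ K w := by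
  induction w with
  | zero => exact h.pos
  | succ w ih =>
    rw [h.succ]
    exact Nat.mul_pos (by have := h.three_le w; omega) ih

theorem three_mul_le (h : CycleData K Q c) (w : ℕ) : 3 * K w ≤ K (w + 1) := by
  rw [h.succ]
  exact Nat.mul_le_mul_right _ (h.three_le w)

theorem strictMono (h : CycleData K Q c) : StrictMono K :=
  strictMono_nat_of_lt_succ fun w => by have := h.three_mul_le w; have := h.K_pos w; omega

theorem cycleIndex_eq (h : CycleData K Q c) {n v : ℕ} (h1 : 2 * K v ≤ n)
    (h2 : n < 2 * K (v + 1)) : cycleIndex K n = v := by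
  rw [cycleIndex, Nat.findGreatest_eq_iff]
  refine ⟨by have := h.strictMono.le_apply (x := v); omega, fun _ => h1, fun {w} hw _ h3 => ?_⟩
  have := h.strictMono.monotone (show v + 1 ≤ w by omega)
  omega

theorem exists_cycle (h : CycleData K Q c) {n : ℕ} (hn : 2 * K 1 ≤ n) :
    ∃ w, 2 * K (w + 1) ≤ n ∧ n < 2 * K (w + 2) := by
  classical
  have hex : ∃ v, n < 2 * K v :=
    ⟨n, by have := h.strictMono.le_apply (x := n); have := h.K_pos n; omega⟩
  have h1 := Nat.find_spec hex
  have h2 : 1 < Nat.find hex := by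
    by_contra h3
    have := h.strictMono.monotone (show Nat.find hex ≤ 1 by omega)
    omega
  refine ⟨Nat.find hex - 2, ?_, ?_⟩
  · have := Nat.find_min hex (show Nat.find hex - 2 + 1 < Nat.find hex by omega)
    omega
  · rwa [Nat.sub_add_cancel (by omega)]

theorem cycleWeights_eq (h : CycleData K Q c) {n w : ℕ} (h1 : 2 * K (w + 1) ≤ n)
    (h2 : n < 2 * K (w + 2)) (j : ℕ) :
    cycleWeights K c n j = c (w + 1) / n +
      if j ∈ Finset.Ioc (K w) (2 * K w) then (1 - c (w + 1)) / K w else 0 := by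
  have h3 := h.strictMono.monotone (show 1 ≤ w + 1 by omega)
  rw [cycleWeights, if_neg (by omega), h.cycleIndex_eq h1 h2, Nat.add_sub_cancel]

theorem sum_cycleWeights_mul (h : CycleData K Q c) {n w : ℕ} (h1 : 2 * K (w + 1) ≤ n)
    (h2 : n < 2 * K (w + 2)) (x : ℕ → ℝ) :
    ∑ j ∈ Finset.Icc 1 n, cycleWeights K c n j * x j =
      c (w + 1) / n * ∑ j ∈ Finset.Icc 1 n, x j +
        (1 - c (w + 1)) / K w * ∑ j ∈ Finset.Ioc (K w) (2 * K w), x j := by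
  simp only [h.cycleWeights_eq h1 h2, add_mul, Finset.sum_add_distrib, ← Finset.mul_sum, ite_mul,
    zero_mul]
  rw [← Finset.sum_filter, ← Finset.mul_sum]
  congr 3
  ext j
  have := h.three_mul_le w
  simp only [Finset.mem_filter, Finset.mem_Icc, Finset.mem_Ioc]
  omega

theorem isProbabilityVector (h : CycleData K Q c) {n : ℕ} (hn : 1 ≤ n) :
    IsProbabilityVector n (cycleWeights K c n) := by
  have hn0 : (n : ℝ) ≠ 0 := by exact_mod_cast (by omega : n ≠ 0)
  rcases Nat.lt_or_ge n (2 * K 1) with hlt | hge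
  · constructor
    · intro j _
      rw [cycleWeights, if_pos hlt]
      positivity
    · simp only [cycleWeights, if_pos hlt]
      rw [Finset.sum_const, Nat.card_Icc, nsmul_eq_mul, Nat.add_sub_cancel]
      field_simp
  · obtain ⟨w, h1, h2⟩ := h.exists_cycle hge
    have hc0 := h.nonneg (w + 1)
    have hc1 := h.le_one (w + 1)
    constructor
    · intro j _
      rw [h.cycleWeights_eq h1 h2]
      have : 0 ≤ (1 - c (w + 1)) / K w := div_nonneg (by linarith) (by positivity)
      split_ifs <;> positivity
    · have := h.sum_cycleWeights_mul h1 h2 fun _ => 1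
      simp only [mul_one] at this
      rw [this, Finset.sum_const, Finset.sum_const, Nat.card_Icc, Nat.card_Ioc, nsmul_eq_mul,
        nsmul_eq_mul, Nat.add_sub_cancel, show 2 * K w - K w = K w by omega]
      have hK : (K w : ℝ) ≠ 0 := by exact_mod_cast (by have := h.K_pos w; omega : K w ≠ 0)
      field_simp
      ring

theorem le_cycleWeights (h : CycleData K Q c) {n w : ℕ} (h1 : 2 * K (w + 1) ≤ n)
    (h2 : n < 2 * K (w + 2)) (j : ℕ) : c (w + 1) / n ≤ cycleWeights K c n j := by
  rw [h.cycleWeights_eq h1 h2]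
  have hc1 := h.le_one (w + 1)
  have : 0 ≤ (1 - c (w + 1)) / K w := div_nonneg (by linarith) (by positivity)
  split_ifs <;> linarith

/-- The block weight is at most `1 / K w`, while `n < 2 * K (w + 2)` is within two growth ratios of
`K w`; monotonicity of `Q` bounds both ratios by `Q (w + 1)`. -/
theorem cycleWeights_le (h : CycleData K Q c) {n w : ℕ} (h1 : 2 * K (w + 1) ≤ n)
    (h2 : n < 2 * K (w + 2)) (j : ℕ) : cycleWeights K c n j ≤ 3 * (Q (w + 1) : ℝ) ^ 2 / n := by
  rw [h.cycleWeights_eq h1 h2]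
  have hc0 := h.nonneg (w + 1)
  have hc1 := h.le_one (w + 1)
  have hK : (0 : ℝ) < K w := by exact_mod_cast h.K_pos w
  have hn0 : (0 : ℝ) < n := by exact_mod_cast (by have := h.K_pos (w + 1); omega : 0 < n)
  have hnle : (n : ℝ) ≤ 2 * (Q (w + 1) : ℝ) ^ 2 * K w := by
    have e1 : n ≤ 2 * (Q (w + 1) * (Q w * K w)) := by
      rw [← h.succ, ← h.succ]; exact h2.le
    have e2 : n ≤ 2 * (Q (w + 1) * (Q (w + 1) * K w)) := by
      refine e1.trans ?_
      have := h.mono (Nat.le_succ w)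
      gcongr
    have e3 : (n : ℝ) ≤ 2 * (Q (w + 1) * (Q (w + 1) * K w)) := by exact_mod_cast e2
    linarith
  have hQ : (1 : ℝ) ≤ (Q (w + 1) : ℝ) ^ 2 := by
    have : (1 : ℝ) ≤ Q (w + 1) := by exact_mod_cast (by have := h.three_le (w + 1); omega)
    exact one_le_pow₀ this
  have b1 : c (w + 1) / n ≤ (Q (w + 1) : ℝ) ^ 2 / n := by
    gcongr
    linarith
  have b2 : (if j ∈ Finset.Ioc (K w) (2 * K w) then (1 - c (w + 1)) / K w else 0) ≤
      2 * (Q (w + 1) : ℝ) ^ 2 / n := by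
    split_ifs
    · rw [div_le_div_iff₀ hK hn0]
      have : (1 - c (w + 1)) * n ≤ 1 * n := by gcongr; linarith
      linarith
    · positivity
  have e : 3 * (Q (w + 1) : ℝ) ^ 2 / n =
      (Q (w + 1) : ℝ) ^ 2 / n + 2 * (Q (w + 1) : ℝ) ^ 2 / n := by ring
  linarith

/-- The averages generated by the cycle weights, started from `1` and then `0`. -/
noncomputable def values (_ : CycleData K Q c) : ℕ → ℝ :=
  averagingExtension (2 * K 1) (cycleWeights K c) fun j => if j ≤ 2 * K 0 then 1 else 0

theorem values_succ (h : CycleData K Q c) {n : ℕ} (hn : 2 * K 1 ≤ n) :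
    h.values (n + 1) = ∑ j ∈ Finset.Icc 1 n, cycleWeights K c n j * h.values j :=
  averagingExtension_succ _ _ hn

theorem values_mem (h : CycleData K Q c) (n : ℕ) (hn : 1 ≤ n) :
    0 ≤ h.values n ∧ h.values n ≤ 1 := by
  induction n using Nat.strong_induction_on with
  | _ n ih =>
    rcases le_or_gt n (2 * K 1) with hle | hgt
    · rw [values, averagingExtension_of_le _ _ hle]
      split_ifs <;> norm_num
    · obtain ⟨r, rfl⟩ : ∃ r, n = r + 1 := ⟨n - 1, by omega⟩
      have hP := h.isProbabilityVector (n := r) (by have := h.K_pos 1; omega)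
      rw [h.values_succ (by omega)]
      have hi : ∀ i ∈ Finset.Icc 1 r, 0 ≤ h.values i ∧ h.values i ≤ 1 := fun i hi =>
        ih i (by rw [Finset.mem_Icc] at hi; omega) (Finset.mem_Icc.1 hi).1
      refine ⟨Finset.sum_nonneg fun i hi' => mul_nonneg (hP.1 i hi') (hi i hi').1, ?_⟩
      rw [← hP.2]
      exact Finset.sum_le_sum fun i hi' => mul_le_of_le_one_right (hP.1 i hi') (hi i hi').2

theorem abs_values_sub_le_one (h : CycleData K Q c) {n : ℕ} (w : ℕ) (hn : 1 ≤ n) :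
    |h.values n - cycleTarget w| ≤ 1 := by
  have := h.values_mem n hn
  rw [abs_le, cycleTarget]
  split_ifs <;> constructor <;> linarith

/-- Block `w + 2` is generated within cycle `w + 1`, whose concentrated mass sits on block `w`. By
Grönwall the total excess error stays below `4 * K (w + 1)`, so from time `K (w + 2)` on the uniform
part adds at most `4 * c / Q`. -/
theorem abs_values_sub_le_of_cycle (h : CycleData K Q c) {w : ℕ} {s : ℝ} (hs : 0 ≤ s)
    (hblock : ∀ j ∈ Finset.Ioc (K w) (2 * K w), |h.values j - cycleTarget w| ≤ s) :
    ∀ j ∈ Finset.Ioc (K (w + 2)) (2 * K (w + 2)),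
      |h.values j - cycleTarget w| ≤ s + 4 * c (w + 1) / Q (w + 1) := by
  set e : ℕ → ℝ := fun j => |h.values j - cycleTarget w| with he
  have hK1 := h.strictMono.monotone (show 1 ≤ w + 1 by omega)
  have hKw : (0 : ℝ) < K w := by exact_mod_cast h.K_pos w
  have hKw1 : (0 : ℝ) < K (w + 1) := by exact_mod_cast h.K_pos (w + 1)
  have hQ : (0 : ℝ) < Q (w + 1) := by exact_mod_cast (by have := h.three_le (w + 1); omega)
  have hc0 := h.nonneg (w + 1)
  have hc1 := h.le_one (w + 1)
  have hKsucc : (K (w + 2) : ℝ) = Q (w + 1) * K (w + 1) := by exact_mod_cast h.succ (w + 1)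
  -- After subtracting `s`, the concentrated mass contributes nothing positive and only the uniform
  -- average remains.
  have hstep : ∀ n, 2 * K (w + 1) ≤ n → n < 2 * K (w + 2) →
      e (n + 1) - s ≤ c (w + 1) / n * ∑ j ∈ Finset.Icc 1 n, (e j - s) := by
    intro n h1 h2
    have hn1 : 1 ≤ n := by have := h.K_pos (w + 1); omega
    have hn0 : (n : ℝ) ≠ 0 := by exact_mod_cast (by omega : n ≠ 0)
    have hP := h.isProbabilityVector hn1
    have b1 : e (n + 1) ≤ ∑ j ∈ Finset.Icc 1 n, cycleWeights K c n j * e j := by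
      have e1 : h.values (n + 1) - cycleTarget w =
          ∑ j ∈ Finset.Icc 1 n, cycleWeights K c n j * (h.values j - cycleTarget w) := by
        simp only [mul_sub, Finset.sum_sub_distrib, ← Finset.sum_mul]
        rw [hP.2, one_mul, h.values_succ (by omega)]
      simp only [he]
      rw [e1]
      refine (Finset.abs_sum_le_sum_abs _ _).trans (Finset.sum_le_sum fun j hj => ?_)
      rw [abs_mul, abs_of_nonneg (hP.1 j hj)]
    rw [h.sum_cycleWeights_mul h1 h2] at b1
    have b2 : ∑ j ∈ Finset.Ioc (K w) (2 * K w), e j ≤ K w * s := by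
      have := Finset.sum_le_card_nsmul _ _ _ hblock
      rwa [Nat.card_Ioc, nsmul_eq_mul, show 2 * K w - K w = K w by omega] at this
    have b3 : (1 - c (w + 1)) / K w * ∑ j ∈ Finset.Ioc (K w) (2 * K w), e j ≤
        (1 - c (w + 1)) / K w * (K w * s) :=
      mul_le_mul_of_nonneg_left b2 (div_nonneg (by linarith) hKw.le)
    have b4 : (1 - c (w + 1)) / K w * (K w * s) = (1 - c (w + 1)) * s := by field_simp
    have b5 : c (w + 1) / n * ∑ j ∈ Finset.Icc 1 n, (e j - s) =
        c (w + 1) / n * ∑ j ∈ Finset.Icc 1 n, e j - c (w + 1) * s := by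
      rw [Finset.sum_sub_distrib, Finset.sum_const, Nat.card_Icc, nsmul_eq_mul,
        Nat.add_sub_cancel]
      field_simp
    linarith
  have hsum := sum_le_two_mul_of_le_average (f := fun j => e j - s) (N := 2 * K (w + 1))
    (L := 2 * K (w + 2)) (by have := h.K_pos (w + 1); omega) hc0
    (fun j hj _ => by have := h.abs_values_sub_le_one w hj; simp only [he]; linarith)
    hstep ?_
  · intro j hj
    rw [Finset.mem_Ioc] at hj
    have h3 : 3 * K (w + 1) ≤ K (w + 2) := h.three_mul_le (w + 1)
    obtain ⟨n, rfl⟩ : ∃ r, j = r + 1 := ⟨j - 1, by omega⟩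
    have hn : K (w + 2) ≤ n := by omega
    have hnR : (K (w + 2) : ℝ) ≤ n := by exact_mod_cast hn
    have hKpos : (0 : ℝ) < K (w + 2) := by exact_mod_cast h.K_pos (w + 2)
    have hn0 : (0 : ℝ) < n := by linarith
    have h4 := hstep n (by omega) (by omega)
    have h5 := hsum n (by omega) (by omega)
    have h6 : c (w + 1) / n * ∑ j ∈ Finset.Icc 1 n, (e j - s) ≤
        c (w + 1) / n * (2 * ((2 * K (w + 1) : ℕ) : ℝ)) := by gcongr
    have h7 : c (w + 1) / n * (2 * ((2 * K (w + 1) : ℕ) : ℝ)) ≤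
        c (w + 1) / K (w + 2) * (2 * ((2 * K (w + 1) : ℕ) : ℝ)) := by gcongr
    have h8 : c (w + 1) / K (w + 2) * (2 * ((2 * K (w + 1) : ℕ) : ℝ)) =
        4 * c (w + 1) / Q (w + 1) := by
      rw [hKsucc]
      push_cast
      field_simp
      norm_num
    linarith
  · push_cast
    rw [hKsucc, Real.log_mul (by norm_num) (by positivity), Real.log_mul hQ.ne' hKw1.ne',
      Real.log_mul (by norm_num) hKw1.ne']
    have := h.log_le (w + 1)
    refine le_trans (le_of_eq ?_) this
    ring

theorem abs_values_sub_le (h : CycleData K Q c) (w : ℕ) :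
    ∀ j ∈ Finset.Ioc (K w) (2 * K w),
      |h.values j - cycleTarget w| ≤ ∑ v ∈ Finset.range w, 4 * c v / Q v := by
  have hterm : ∀ v, 0 ≤ 4 * c v / Q v := fun v => by have := h.nonneg v; positivity
  induction w using Nat.strong_induction_on with
  | _ w ih =>
    intro j hj
    have h3 := h.three_mul_le 0
    have h4 : K (0 + 1) = K 1 := rfl
    match w with
    | 0 =>
      rw [Finset.mem_Ioc] at hj
      rw [values, averagingExtension_of_le _ _ (by omega), if_pos hj.2]
      simp [cycleTarget]
    | 1 =>
      rw [Finset.mem_Ioc] at hj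
      rw [values, averagingExtension_of_le _ _ hj.2, if_neg (by omega)]
      have := hterm 0
      simpa [cycleTarget] using this
    | w + 2 =>
      rw [cycleTarget_add_two]
      have := h.abs_values_sub_le_of_cycle (Finset.sum_nonneg fun v _ => hterm v)
        (ih w (by omega)) j hj
      rw [Finset.sum_range_succ, Finset.sum_range_succ]
      linarith [hterm w]

theorem not_tendsto_values (h : CycleData K Q c) (l : ℝ) :
    ¬ Filter.Tendsto h.values Filter.atTop (nhds l) := by
  intro hl
  obtain ⟨N, hN⟩ := Metric.tendsto_atTop.1 hl (1 / 8) (by norm_num)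
  -- A limit would lie within `1 / 8 + 1 / 4 = 3 / 8` of both targets, which are `1` apart.
  have hb : ∀ w, N ≤ w → |cycleTarget w - l| < 3 / 8 := by
    intro w hw
    have h1 := h.K_pos w
    have h2 := h.strictMono.le_apply (x := w)
    have h3 := h.abs_values_sub_le w (2 * K w) (by rw [Finset.mem_Ioc]; omega)
    have h4 := hN (2 * K w) (by omega)
    have h5 := h.sum_le w
    rw [Real.dist_eq] at h4
    rw [abs_lt] at h4 ⊢
    rw [abs_le] at h3
    constructor <;> linarith
  have h1 := hb (2 * N) (by omega)
  have h2 := hb (2 * N + 1) (by omega)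
  have e1 : cycleTarget (2 * N) = 1 := by simp [cycleTarget]
  have e2 : cycleTarget (2 * N + 1) = 0 := by simp [cycleTarget]
  rw [e1, abs_lt] at h1
  rw [e2, abs_lt] at h2
  linarith

end CycleData

/-! ### Choice of the parameters and divergence -/

/-- The growth ratio of the blocks at the scale `r`. -/
noncomputable def blockRatio (B β r : ℝ) : ℕ := ⌊√(B / 3) * r ^ (β / 2)⌋₊

theorem blockRatio_sq_le {B β r : ℝ} (hB : 0 < B) (hr : 0 ≤ r) :
    3 * (blockRatio B β r : ℝ) ^ 2 ≤ B * r ^ β := by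
  have h1 : (blockRatio B β r : ℝ) ≤ √(B / 3) * r ^ (β / 2) := Nat.floor_le (by positivity)
  have h2 := pow_le_pow_left₀ (Nat.cast_nonneg _) h1 2
  rw [mul_pow, Real.sq_sqrt (by positivity), ← Real.rpow_natCast (r ^ (β / 2)),
    ← Real.rpow_mul hr] at h2
  have e : β / 2 * ((2 : ℕ) : ℝ) = β := by push_cast; ring
  rw [e] at h2
  linarith

theorem monotone_blockRatio {B β : ℝ} (hβ : 0 < β) (w₀ : ℕ) :
    Monotone fun w : ℕ => blockRatio B β ((w : ℝ) + w₀) := by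
  intro v w hvw
  have : (v : ℝ) ≤ w := by exact_mod_cast hvw
  have h2 : ((v : ℝ) + w₀) ^ (β / 2) ≤ ((w : ℝ) + w₀) ^ (β / 2) :=
    Real.rpow_le_rpow (by positivity) (by linarith) (by positivity)
  exact Nat.floor_le_floor (mul_le_mul_of_nonneg_left h2 (Real.sqrt_nonneg _))

theorem eventually_three_le_blockRatio {B β : ℝ} (hB : 0 < B) (hβ : 0 < β) :
    ∀ᶠ r : ℝ in Filter.atTop, 3 ≤ blockRatio B β r := by
  have h1 : Filter.Tendsto (fun r : ℝ => √(B / 3) * r ^ (β / 2)) Filter.atTop Filter.atTop :=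
    (tendsto_rpow_atTop (by positivity)).const_mul_atTop (Real.sqrt_pos.2 (by positivity))
  filter_upwards [h1.eventually_ge_atTop 3] with r hr
  exact Nat.le_floor (by exact_mod_cast hr)

/-- The logarithm of the ratio is `O(log r)`, and `α > 0` makes `r ^ (-α) * log r` vanish. -/
theorem eventually_log_blockRatio_le {A B α β : ℝ} (hA : 0 < A) (hB : 0 < B) (hα : 0 < α)
    (hβ : 0 < β) :
    ∀ᶠ r : ℝ in Filter.atTop,
      2 * (A * r ^ (-α)) * Real.log (blockRatio B β r) ≤ Real.log 2 := by
  have h1 : Filter.Tendsto (fun r : ℝ => 2 * A * Real.log √(B / 3) * r ^ (-α) +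
      A * β * (Real.log r / r ^ α)) Filter.atTop (nhds 0) := by
    have e1 := (tendsto_rpow_neg_atTop hα).const_mul (2 * A * Real.log √(B / 3))
    have e2 := (isLittleO_log_rpow_atTop hα).tendsto_div_nhds_zero.const_mul (A * β)
    simpa using e1.add e2
  have hlog2 : 0 < Real.log 2 := Real.log_pos (by norm_num)
  filter_upwards [h1.eventually_lt_const hlog2, eventually_three_le_blockRatio hB hβ,
    Filter.eventually_gt_atTop 0] with r h2 h3 hr
  refine le_trans ?_ h2.le
  have hs : 0 < √(B / 3) := Real.sqrt_pos.2 (by positivity)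
  have hrp : 0 < r ^ (β / 2) := Real.rpow_pos_of_pos hr _
  have hra : 0 < r ^ α := Real.rpow_pos_of_pos hr _
  have h4 : Real.log (blockRatio B β r) ≤ Real.log √(B / 3) + β / 2 * Real.log r := by
    rw [← Real.log_rpow hr, ← Real.log_mul hs.ne' hrp.ne']
    exact Real.log_le_log (by exact_mod_cast (by omega : 0 < blockRatio B β r))
      (Nat.floor_le (by positivity))
  rw [Real.rpow_neg hr.le]
  have h5 : 2 * (A * (r ^ α)⁻¹) * Real.log (blockRatio B β r) ≤
      2 * (A * (r ^ α)⁻¹) * (Real.log √(B / 3) + β / 2 * Real.log r) := by gcongr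
  refine h5.trans (le_of_eq ?_)
  field_simp

/-- The source of the critical exponent: floor over ratio is of order `r ^ (-(α + β / 2))`. Rounding
down a number whose floor is at least `3` loses less than a factor `2`. -/
theorem div_blockRatio_le {A B α β r : ℝ} (hA : 0 < A) (hB : 0 < B) (hr : 0 < r)
    (h3 : 3 ≤ blockRatio B β r) :
    4 * (A * r ^ (-α)) / blockRatio B β r ≤ 8 * A / √(B / 3) * r ^ (-(α + β / 2)) := by
  have hs : 0 < √(B / 3) := Real.sqrt_pos.2 (by positivity)
  have hrp : 0 < r ^ (β / 2) := Real.rpow_pos_of_pos hr _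
  have hra : 0 < r ^ (-α) := Real.rpow_pos_of_pos hr _
  have h1 : √(B / 3) * r ^ (β / 2) / 2 ≤ blockRatio B β r := by
    have h2 := (Nat.lt_floor_add_one (√(B / 3) * r ^ (β / 2))).le
    have h4 : (3 : ℝ) ≤ (⌊√(B / 3) * r ^ (β / 2)⌋₊ : ℝ) := by exact_mod_cast h3
    rw [blockRatio]
    linarith
  have h5 : 4 * (A * r ^ (-α)) / blockRatio B β r ≤
      4 * (A * r ^ (-α)) / (√(B / 3) * r ^ (β / 2) / 2) := by gcongr
  refine h5.trans (le_of_eq ?_)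
  rw [neg_add, Real.rpow_add hr, Real.rpow_neg hr.le (β / 2)]
  field_simp
  norm_num

theorem exists_sum_shift_le {γ M : ℝ} (hγ : 1 < γ) (hM : 0 ≤ M) :
    ∀ᶠ w₀ : ℕ in Filter.atTop, ∀ V : ℕ,
      ∑ v ∈ Finset.range V, M * ((v : ℝ) + w₀) ^ (-γ) ≤ 1 / 4 := by
  set g : ℕ → ℝ := fun n => M * (n : ℝ) ^ (-γ) with hg
  have hs : Summable g := (Real.summable_nat_rpow.2 (by linarith)).mul_left M
  have hg0 : ∀ n, 0 ≤ g n := fun n => mul_nonneg hM (Real.rpow_nonneg (Nat.cast_nonneg _) _)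
  filter_upwards [(tendsto_sum_nat_add g).eventually_lt_const (by norm_num : (0 : ℝ) < 1 / 4)]
    with w₀ hw V
  refine le_trans ?_ hw.le
  have h1 := ((summable_nat_add_iff w₀).2 hs).sum_le_tsum (Finset.range V) fun i _ => hg0 (i + w₀)
  refine le_trans (le_of_eq ?_) h1
  simp [hg]

theorem exists_cycleData {A B α β : ℝ} (hA : 0 < A) (hB : 0 < B) (hα : 0 < α) (hβ : 0 < β)
    (hαβ : 1 < α + β / 2) :
    ∃ (K Q : ℕ → ℕ) (w₀ : ℕ), 1 ≤ w₀ ∧ CycleData K Q (fun w => A * ((w : ℝ) + w₀) ^ (-α)) ∧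
      (∀ w, 3 * (Q w : ℝ) ^ 2 ≤ B * ((w : ℝ) + w₀) ^ β) ∧
      ∀ w : ℕ, Real.exp ((w : ℝ) + w₀) ≤ K w := by
  have hAlim : ∀ᶠ r : ℝ in Filter.atTop, A * r ^ (-α) ≤ 1 := by
    have := (tendsto_rpow_neg_atTop hα).const_mul A
    rw [mul_zero] at this
    filter_upwards [this.eventually_lt_const one_pos] with r hr
    exact hr.le
  obtain ⟨r₀, hr₀⟩ := Filter.eventually_atTop.1 (hAlim.and
    ((eventually_three_le_blockRatio hB hβ).and (eventually_log_blockRatio_le hA hB hα hβ)))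
  -- Starting the cycles at a late scale `w₀` makes all eventual bounds hold from the first cycle
  -- and the tail of the error series at most `1 / 4`.
  obtain ⟨w₀, hsum, hw₀⟩ := ((exists_sum_shift_le (M := 8 * A / √(B / 3)) hαβ
    (by positivity)).and (Filter.eventually_ge_atTop (max 1 ⌈r₀⌉₊))).exists
  have hw1 : 1 ≤ w₀ := (le_max_left _ _).trans hw₀
  have hw1R : (1 : ℝ) ≤ w₀ := by exact_mod_cast hw1
  have hr : ∀ w : ℕ, r₀ ≤ (w : ℝ) + w₀ := by
    intro w
    have h1 : (⌈r₀⌉₊ : ℝ) ≤ w₀ := by exact_mod_cast (le_max_right _ _).trans hw₀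
    have h2 := Nat.le_ceil r₀
    have h3 : (0 : ℝ) ≤ w := Nat.cast_nonneg w
    linarith
  have hpos : ∀ w : ℕ, 0 < (w : ℝ) + w₀ := fun w => by positivity
  set Q : ℕ → ℕ := fun w => blockRatio B β ((w : ℝ) + w₀) with hQ
  have hQ3 : ∀ w, 3 ≤ Q w := fun w => (hr₀ _ (hr w)).2.1
  set K : ℕ → ℕ := fun w => Nat.rec ⌈Real.exp w₀⌉₊ (fun w K => Q w * K) w with hK
  have hKsucc : ∀ w, K (w + 1) = Q w * K w := fun w => rfl
  have hK0 : Real.exp w₀ ≤ K 0 := Nat.le_ceil _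
  refine ⟨K, Q, w₀, hw1, ⟨?_, hKsucc, hQ3, monotone_blockRatio hβ w₀, fun w => ?_,
    fun w => (hr₀ _ (hr w)).1, fun w => (hr₀ _ (hr w)).2.2, fun V => ?_⟩,
    fun w => blockRatio_sq_le hB (hpos w).le, fun w => ?_⟩
  · exact_mod_cast (Real.exp_pos _).trans_le hK0
  · exact mul_nonneg hA.le (Real.rpow_nonneg (hpos w).le _)
  · exact (Finset.sum_le_sum fun v _ => div_blockRatio_le hA hB (hpos v) (hQ3 v)).trans (hsum V)
  · induction w with
    | zero => simpa using hK0
    | succ w ih =>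
      rw [hKsucc]
      push_cast
      have e : (w : ℝ) + 1 + w₀ = 1 + (w + w₀) := by ring
      rw [e, Real.exp_add]
      -- Ratios of at least `3 > e` keep `log (K w)` above `w + w₀`.
      have h1 : Real.exp 1 ≤ Q w := by
        have h2 : (3 : ℝ) ≤ Q w := by exact_mod_cast hQ3 w
        linarith [Real.exp_one_lt_d9]
      gcongr

/-- Only `log n ≥ w + w₀` is needed: the floor decreases and the ceiling coefficient increases with
`log n`, so both conditions only get easier as `log n` grows. -/
theorem isAdmissible_cycleWeights {A B α β : ℝ} (hA : 0 < A) (hB : 0 < B) (hα : 0 < α)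
    (hβ : 0 < β) {K Q : ℕ → ℕ} {w₀ : ℕ} (hw₀ : 1 ≤ w₀)
    (h : CycleData K Q (fun w => A * ((w : ℝ) + w₀) ^ (-α)))
    (hQ : ∀ w, 3 * (Q w : ℝ) ^ 2 ≤ B * ((w : ℝ) + w₀) ^ β)
    (hK : ∀ w : ℕ, Real.exp ((w : ℝ) + w₀) ≤ K w) :
    IsAdmissible A B α β (2 * K 1)
      (cycleWeights K (fun w => A * ((w : ℝ) + w₀) ^ (-α))) := by
  have hlog : ∀ {n w : ℕ}, 2 * K w ≤ n → (w : ℝ) + w₀ ≤ Real.log n := by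
    intro n w hn
    have h1 : (K w : ℝ) ≤ n := by exact_mod_cast (by omega : K w ≤ n)
    have hn0 : (0 : ℝ) < n := (Real.exp_pos _).trans_le ((hK w).trans h1)
    exact (Real.le_log_iff_exp_le hn0).2 ((hK w).trans h1)
  have hpos : ∀ w : ℕ, 0 < (w : ℝ) + w₀ := fun w => by
    have : (1 : ℝ) ≤ w₀ := by exact_mod_cast hw₀
    positivity
  refine ⟨fun n hn => h.isProbabilityVector hn, fun n hn _ j _ => ?_, fun n hn _ j _ => ?_⟩
  · obtain ⟨w, h1, h2⟩ := h.exists_cycle hn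
    refine le_trans ?_ (h.le_cycleWeights h1 h2 j)
    have := Real.rpow_le_rpow_of_nonpos (hpos _) (hlog h1) (neg_nonpos.2 hα.le)
    gcongr
  · obtain ⟨w, h1, h2⟩ := h.exists_cycle hn
    refine (h.cycleWeights_le h1 h2 j).trans ?_
    have h3 := Real.rpow_le_rpow (hpos _).le (hlog h1) hβ.le
    have h4 : B * (((w + 1 : ℕ) : ℝ) + w₀) ^ β ≤ B * Real.log n ^ β := by gcongr
    have h5 := (hQ (w + 1)).trans h4
    gcongr

theorem exists_not_sequenceConverges {A B α β : ℝ} (hA : 0 < A) (hB : 0 < B) (hα : 0 < α)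
    (hβ : 0 < β) (hαβ : 1 < α + β / 2) {d : ℕ} (hd : 1 ≤ d) :
    ∃ k : ℕ, 1 ≤ k ∧ ∃ p : ℕ → ℕ → ℝ, IsAdmissible A B α β k p ∧
      ∃ a : ℕ → EuclideanSpace ℝ (Fin d), IsAveragingSequence k p a ∧ ¬ SequenceConverges a := by
  obtain ⟨K, Q, w₀, hw₀, h, hQ, hK⟩ := exists_cycleData hA hB hα hβ hαβ
  set e : EuclideanSpace ℝ (Fin d) := EuclideanSpace.single ⟨0, hd⟩ 1 with he
  refine ⟨2 * K 1, by have := h.K_pos 1; omega, _,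
    isAdmissible_cycleWeights hA hB hα hβ hw₀ h hQ hK, fun n => h.values n • e, fun n hn => ?_, ?_⟩
  · simp only [smul_smul]
    rw [h.values_succ hn, Finset.sum_smul]
  · rintro ⟨l, hl⟩
    apply h.not_tendsto_values (l ⟨0, hd⟩)
    have h1 : Filter.Tendsto (fun n => (h.values n • e) ⟨0, hd⟩) Filter.atTop
        (nhds (l ⟨0, hd⟩)) :=
      ((EuclideanSpace.proj (𝕜 := ℝ) (⟨0, hd⟩ : Fin d)).continuous.tendsto l).comp hl
    simpa [he] using h1

theorem theorem1 (A B α β : ℝ) (hA : 0 < A) (hB : 0 < B) (hα : 0 ≤ α) (hβ : 0 ≤ β) :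
    (α + β / 2 ≤ 1 →
      ∀ (d k : ℕ), 1 ≤ k → ∀ p : ℕ → ℕ → ℝ, IsAdmissible A B α β k p →
        ∀ a : ℕ → EuclideanSpace ℝ (Fin d), IsAveragingSequence k p a → SequenceConverges a) ∧
    (0 < α → 0 < β → 1 < α + β / 2 →
      ∀ d : ℕ, 1 ≤ d →
        ∃ k : ℕ, 1 ≤ k ∧ ∃ p : ℕ → ℕ → ℝ, IsAdmissible A B α β k p ∧
          ∃ a : ℕ → EuclideanSpace ℝ (Fin d),
            IsAveragingSequence k p a ∧ ¬ SequenceConverges a) :=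
  ⟨fun hαβ _ _ hk _ hp _ ha => sequenceConverges_of_averaging hA hB hα hβ hαβ hk hp ha,
    fun hα' hβ' hαβ _ hd => exists_not_sequenceConverges hA hB hα' hβ' hαβ hd⟩
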